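/- Let $p$ be a prime, let $S$ be a finite $p$-group and let $\mathcal F$ be a saturated fusion system over $S$ (in the sense of Broto, Levi and Oliver). Let $A \le S$ be central in $\mathcal F$, that is, $A$ is contained in the center $Z_{\mathcal F}(S) = \varprojlim_{\mathcal F^c} Z(-)$ of $\mathcal F$, the subgroup of those $z \in Z(S)$ which are fixed by all morphisms between $\mathcal F$-centric subgroups of $S$. For $P \le S$ and $\varphi\colon P \to S$, let $S \times_{(P,\varphi)} S$ be the quotient of $S\times S$ by the relations $(x\varphi(g),y)\sim(x,gy)$, $g\in P$, with $S$ acting on the left on the first coordinate and on the right on the second. A characteristic biset of $\mathcal F$ is a finite set $\Lambda$ with commuting left and right actions of $S$ such that (1) $\Lambda$ is isomorphic to a disjoint union of bisets $S \times_{(P,\varphi)} S$ with $P \le S$ and $\varphi \in \mathrm{Hom}_{\mathcal F}(P,S)$; (2) for every $P \le S$ and $\varphi \in \mathrm{Hom}_{\mathcal F}(P,S)$, the $(P,S)$-bisets obtained from $\Lambda$ by restricting the left action along the inclusion $P \to S$ and along $\varphi$ are isomorphic; (3) $|\Lambda|/|S| \equiv 1 \pmod p$. For a homomorphism $\chi\colon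 A \to S^1$, a representation $\rho\colon S \to U_n$ is called an $A$-representation (with respect to $\chi$) if $\rho(a)$ is multiplication by $\chi(a)$ for all $a\in A$. A representation $\rho\colon S \to U_n$ is $\mathcal F$-invariant if $\rho|_P$ and $\rho\circ f$ are isomorphic for all $P \le S$ and $f\in \mathrm{Hom}_{\mathcal F}(P,S)$. Then: (i) there is a characteristic biset $\Lambda$ of $\mathcal F$ such that $ax = xa$ for all $a\in A$ and $x \in \Lambda$; (ii) for every homomorphism $\chi\colon A\to S^1$ and every $A$-representation $\rho$ of $S$ with respect to $\chi$, there is an $\mathcal F$-invariant $A$-representation of $S$ with respect to the same $\chi$ which contains $\rho$ as a direct summand. -/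

import Mathlib

universe u

/-! ### Fusion systems -/

/-- A fusion system over `S`: a category whose objects are the subgroups of `S`, whose morphisms
`P ⟶ Q` are injective homomorphisms, which contains all the homomorphisms induced by conjugation
in `S`, and in which every morphism is an isomorphism of the category followed by an inclusion.
(Identities are conjugation by `1`.) -/
structure FusionSystem (S : Type u) [Group S] where
  /-- The morphisms from `P` to `Q`. -/
  Hom : ∀ P Q : Subgroup S, Set (P →* Q)
  comp_mem : ∀ {P Q R : Subgroup S} {φ : P →* Q} {ψ : Q →* R},
    φ ∈ Hom P Q → ψ ∈ Hom Q R → ψ.comp φ ∈ Hom P R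
  conj_mem : ∀ {P Q : Subgroup S} (φ : P →* Q) (g : S),
    (∀ x : P, (φ x : S) = g * (x : S) * g⁻¹) → φ ∈ Hom P Q
  injective : ∀ {P Q : Subgroup S} {φ : P →* Q}, φ ∈ Hom P Q → Function.Injective φ
  factor : ∀ {P Q : Subgroup S} {φ : P →* Q}, φ ∈ Hom P Q →
    ∃ (R : Subgroup S) (hR : R ≤ Q) (e : P ≃* R),
      e.toMonoidHom ∈ Hom P R ∧ e.symm.toMonoidHom ∈ Hom R P ∧
        φ = (Subgroup.inclusion hR).comp e.toMonoidHom

/-- `Aut_S(P)`: the automorphisms of `P` induced by conjugation by elements of `N_S(P)`. -/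
def autS {S : Type u} [Group S] (P : Subgroup S) : Subgroup (MulAut P) :=
  P.normalizerMonoidHom.range

/-- `N_φ = {g ∈ N_S(P) | φ c_g φ⁻¹ ∈ Aut_S(φ(P))}` for an injective `φ : P → S`. -/
noncomputable def extensionDomain {S : Type u} [Group S] {P : Subgroup S} (φ : P →* S)
    (hφ : Function.Injective φ) : Subgroup S :=
  ((autS φ.range).comap ((MulAut.congr (MonoidHom.ofInjective hφ)).toMonoidHom.comp
    P.normalizerMonoidHom)).map (Subgroup.normalizer (P : Set S)).subtype

theorem le_extensionDomain {S : Type u} [Group S] {P : Subgroup S} (φ : P →* S)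
    (hφ : Function.Injective φ) : P ≤ extensionDomain φ hφ := by
  intro x hx
  refine ⟨⟨x, Subgroup.le_normalizer hx⟩, ?_, rfl⟩
  refine ⟨⟨φ ⟨x, hx⟩, Subgroup.le_normalizer ⟨⟨x, hx⟩, rfl⟩⟩, ?_⟩
  ext y
  obtain ⟨z, rfl⟩ := (MonoidHom.ofInjective hφ).surjective y
  have h : (P.normalizerMonoidHom ⟨x, Subgroup.le_normalizer hx⟩) z
      = (⟨x, hx⟩ : P) * z * (⟨x, hx⟩ : P)⁻¹ := Subtype.ext rfl
  simp [MulAut.congr, h]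
  rfl

namespace FusionSystem

variable {S : Type u} [Group S] (F : FusionSystem S)

/-- `Hom_F(P, S)`, with the target regarded as `S` itself instead of `⊤`. -/
def HomS (P : Subgroup S) : Set (P →* S) :=
  {φ | φ.codRestrict (⊤ : Subgroup S) (fun _ => Subgroup.mem_top _) ∈ F.Hom P ⊤}

theorem HomS.injective {P : Subgroup S} {φ : P →* S} (hφ : φ ∈ F.HomS P) :
    Function.Injective φ :=
  fun _ _ h => F.injective hφ (Subtype.ext h)

/-- `P` and `Q` are `F`-conjugate: isomorphic in the category `F`. -/
def IsConj (P Q : Subgroup S) : Prop :=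
  ∃ e : P ≃* Q, e.toMonoidHom ∈ F.Hom P Q ∧ e.symm.toMonoidHom ∈ F.Hom Q P

/-- `P` is fully centralized in `F`. -/
def FullyCentralized (P : Subgroup S) : Prop :=
  ∀ Q : Subgroup S, F.IsConj P Q →
    Nat.card (Subgroup.centralizer (Q : Set S)) ≤ Nat.card (Subgroup.centralizer (P : Set S))

/-- `P` is fully normalized in `F`. -/
def FullyNormalized (P : Subgroup S) : Prop :=
  ∀ Q : Subgroup S, F.IsConj P Q →
    Nat.card (Subgroup.normalizer (Q : Set S)) ≤ Nat.card (Subgroup.normalizer (P : Set S))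

/-- `Aut_F(P)`: the automorphisms of `P` in the category `F`. -/
def autF (P : Subgroup S) : Subgroup (MulAut P) where
  carrier := {e | MulEquiv.toMonoidHom e ∈ F.Hom P P ∧ MulEquiv.toMonoidHom e⁻¹ ∈ F.Hom P P}
  one_mem' := ⟨F.conj_mem _ 1 fun x => by simp, F.conj_mem _ 1 fun x => by simp⟩
  mul_mem' := fun {a b} ha hb => by
    refine ⟨F.comp_mem hb.1 ha.1, ?_⟩
    rw [mul_inv_rev]
    exact F.comp_mem ha.2 hb.2
  inv_mem' := fun {a} ha => ⟨ha.2, by rw [inv_inv]; exact ha.1⟩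

/-- Saturation of a fusion system over a finite `p`-group. -/
structure IsSaturated (p : ℕ) : Prop where
  fullyCentralized : ∀ P : Subgroup S, F.FullyNormalized P → F.FullyCentralized P
  autS_le : ∀ P : Subgroup S, F.FullyNormalized P → autS P ≤ F.autF P
  sylow : ∀ P : Subgroup S, F.FullyNormalized P →
    ∃ T : Sylow p (F.autF P), (T : Subgroup (F.autF P)) = (autS P).subgroupOf (F.autF P)
  extend : ∀ (P : Subgroup S) (φ : P →* S) (hφ : φ ∈ F.HomS P), F.FullyCentralized φ.range →
    ∃ ψ ∈ F.HomS (extensionDomain φ (HomS.injective F hφ)),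
      ψ.comp (Subgroup.inclusion (le_extensionDomain φ (HomS.injective F hφ))) = φ

/-- `P` is `F`-centric: all the `F`-conjugates of `P` (`P` included) contain their
`S`-centralizers. -/
def IsCentric (P : Subgroup S) : Prop :=
  ∀ Q : Subgroup S, F.IsConj P Q → Subgroup.centralizer (Q : Set S) ≤ Q

/-- The center `Z_F(S)` of `F`, the inverse limit of `P ↦ Z(P)` over the `F`-centric subgroups.
As `S` is `F`-centric and every `Z(P)` with `P` centric contains `Z(S)`, a compatible family is
constantly equal to an element `z` of `Z(S)`, and compatibility says that `z` is fixed by all the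
morphisms between `F`-centric subgroups. -/
def center : Subgroup S where
  carrier := {z | z ∈ Subgroup.center S ∧ ∀ P Q : Subgroup S, F.IsCentric P → F.IsCentric Q →
    ∀ φ ∈ F.Hom P Q, ∃ hz : z ∈ P, (φ ⟨z, hz⟩ : S) = z}
  one_mem' := ⟨one_mem _, fun P _ _ _ φ _ => ⟨one_mem P, by
    change ((φ 1 : _) : S) = 1
    simp⟩⟩
  mul_mem' := fun {a b} ha hb => ⟨mul_mem ha.1 hb.1, fun P Q hP hQ φ hφ => by
    obtain ⟨h1, e1⟩ := ha.2 P Q hP hQ φ hφ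
    obtain ⟨h2, e2⟩ := hb.2 P Q hP hQ φ hφ
    refine ⟨mul_mem h1 h2, ?_⟩
    change ((φ ((⟨a, h1⟩ : P) * ⟨b, h2⟩) : _) : S) = a * b
    rw [map_mul, Subgroup.coe_mul, e1, e2]⟩
  inv_mem' := fun {a} ha => ⟨inv_mem ha.1, fun P Q hP hQ φ hφ => by
    obtain ⟨h1, e1⟩ := ha.2 P Q hP hQ φ hφ
    refine ⟨inv_mem h1, ?_⟩
    change ((φ ((⟨a, h1⟩ : P)⁻¹) : _) : S) = a⁻¹
    rw [map_inv, Subgroup.coe_inv, e1]⟩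

end FusionSystem

/-! ### Bisets -/

/-- The relation `(x φ(g), y) ∼ (x, g y)` for `g ∈ P` on `S × S`. -/
def transBisetSetoid {S : Type u} [Group S] (P : Subgroup S) (φ : P →* S) : Setoid (S × S) where
  r a b := ∃ g : P, a.1 = b.1 * φ g ∧ b.2 = (g : S) * a.2
  iseqv :=
    { refl := fun a => ⟨1, by simp, by simp⟩
      symm := fun {a b} => by
        rintro ⟨g, h1, h2⟩
        exact ⟨g⁻¹, by simp [h1], by simp [h2]⟩
      trans := fun {a b c} => by
        rintro ⟨g, h1, h2⟩ ⟨h, h3, h4⟩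
        exact ⟨h * g, by simp [h1, h3, mul_assoc], by simp [h2, h4, mul_assoc]⟩ }

/-- The `(S, S)`-biset `S ×_(P, φ) S`. -/
def TransBiset {S : Type u} [Group S] (P : Subgroup S) (φ : P →* S) : Type u :=
  Quotient (transBisetSetoid P φ)

/-- Left action `s [x, y] = [s x, y]`. -/
instance {S : Type u} [Group S] (P : Subgroup S) (φ : P →* S) : MulAction S (TransBiset P φ) where
  smul s := Quotient.map (fun a => (s * a.1, a.2)) (by
    rintro a b ⟨g, h1, h2⟩
    exact ⟨g, by simp [h1, mul_assoc], h2⟩)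
  one_smul := by
    rintro ⟨x⟩
    exact congrArg (Quotient.mk _) (by simp)
  mul_smul := by
    rintro s t ⟨x⟩
    exact congrArg (Quotient.mk _) (by simp [mul_assoc])

/-- Right action `[x, y] t = [x, y t]`. -/
instance {S : Type u} [Group S] (P : Subgroup S) (φ : P →* S) :
    MulAction Sᵐᵒᵖ (TransBiset P φ) where
  smul t := Quotient.map (fun a => (a.1, a.2 * t.unop)) (by
    rintro a b ⟨g, h1, h2⟩
    exact ⟨g, h1, by simp [h2, mul_assoc]⟩)
  one_smul := by
    rintro ⟨x⟩
    exact congrArg (Quotient.mk _) (by simp)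
  mul_smul := by
    rintro s t ⟨x⟩
    exact congrArg (Quotient.mk _) (by simp [mul_assoc])

/-- `Λ` is a characteristic biset of the fusion system `F` over the `p`-group `S`. -/
structure FusionSystem.IsCharacteristicBiset {S : Type u} [Group S] (F : FusionSystem S) (p : ℕ)
    (Λ : Type u) [MulAction S Λ] [MulAction Sᵐᵒᵖ Λ] [SMulCommClass S Sᵐᵒᵖ Λ] : Prop where
  finite : Finite Λ
  /-- `Λ` is isomorphic to a disjoint union of bisets `S ×_(P, φ) S` with `φ ∈ Hom_F(P, S)`. -/
  components : ∃ (ι : Type u) (P : ι → Subgroup S) (φ : ∀ i, P i →* S),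
    (∀ i, φ i ∈ F.HomS (P i)) ∧
    ∃ e : Λ ≃ Σ i, TransBiset (P i) (φ i),
      (∀ (s : S) (x : Λ), e (s • x) = s • e x) ∧
      (∀ (t : Sᵐᵒᵖ) (x : Λ), e (t • x) = t • e x)
  /-- Restricting the left action to `P` along the inclusion and along `φ ∈ Hom_F(P, S)` gives
  isomorphic `(P, S)`-bisets. -/
  stable : ∀ (P : Subgroup S), ∀ φ ∈ F.HomS P, ∃ e : Λ ≃ Λ,
    (∀ (g : P) (x : Λ), e ((g : S) • x) = φ g • e x) ∧
    (∀ (t : Sᵐᵒᵖ) (x : Λ), e (t • x) = t • e x)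
  card : Nat.card Λ / Nat.card S ≡ 1 [MOD p]

/-! ### Unitary representations -/

/-- The representation on `ℂⁿ` given by a homomorphism to `U(n)`. -/
def unitaryRep {G : Type u} [Group G] {n : ℕ} (ρ : G →* Matrix.unitaryGroup (Fin n) ℂ) :
    Representation ℂ G (Fin n → ℂ) :=
  (Matrix.toLinAlgEquiv' : Matrix (Fin n) (Fin n) ℂ ≃ₐ[ℂ] _).toMonoidHom.comp
    ((Matrix.unitaryGroup (Fin n) ℂ).subtype.comp ρ)

/-- The unitary representation `ρ` of `S` is `F`-invariant: `ρ|_P` and `ρ ∘ f` are isomorphic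
for all `P ≤ S` and `f ∈ Hom_F(P, S)`. -/
def FusionSystem.IsInvariantRep {S : Type u} [Group S] (F : FusionSystem S) {n : ℕ}
    (ρ : S →* Matrix.unitaryGroup (Fin n) ℂ) : Prop :=
  ∀ (P : Subgroup S), ∀ f ∈ F.HomS P,
    Nonempty ((unitaryRep (ρ.comp P.subtype)).Equiv (unitaryRep (ρ.comp f)))

/-- `A` acts through `ρ` by multiplication with the complex numbers given by `χ : A → S¹`. -/
def IsARep {S : Type u} [Group S] {A : Subgroup S} (χ : A →* Circle) {n : ℕ}
    (ρ : S →* Matrix.unitaryGroup (Fin n) ℂ) : Prop :=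
  ∀ (a : A) (v : Fin n → ℂ), unitaryRep ρ (a : S) v = (χ a : ℂ) • v

/-- `ρ` is a direct summand of `τ`. -/
def IsDirectSummand {G : Type u} [Group G] {n m : ℕ} (ρ : G →* Matrix.unitaryGroup (Fin n) ℂ)
    (τ : G →* Matrix.unitaryGroup (Fin m) ℂ) : Prop :=
  ∃ (k : ℕ) (σ : G →* Matrix.unitaryGroup (Fin k) ℂ),
    Nonempty ((unitaryRep τ).Equiv ((unitaryRep ρ).prod (unitaryRep σ)))

/-!
A morphism `φ : P → S` of the fusion system `F` is encoded by its graph `{(φ y, y) | y ∈ P}`, a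
subgroup of `S × S`. The set `F.graphs` of these subgroups is closed under subgroups, converses,
composition of relations and conjugation, and the extension domain of `φ` is the second projection
of the normalizer of the graph (`IsSaturated.exists_graph_extension`).

*Central subgroups.* If `A` is central in `F`, every morphism of `F` extends to one whose domain
contains `A` and which is the identity on `A` (`IsSaturated.exists_graph_extension_center`). For
morphisms with centric domain this is the definition of the center. In general one goes by induction
on the index of the domain, writing a morphism with non-centric domain as a composite of morphisms
which extend to larger domains, as in the proof of Alperin's fusion theorem.

*The biset.* An `(S, S)`-biset is an `(S × S)`-set, and `S ×_(P, φ) S` is the set of cosets of the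
graph of `φ`. A multiplicity function on the graphs which contain the diagonal of `A` describes a
biset on which both actions of `A` coincide. It satisfies the stability condition as soon as the
number of fixed points of such a graph depends only on the domain of the morphism: finite sets with
a group action are determined by their numbers of fixed points (`exists_equivariant_equiv`), a
subgroup which is not a graph has no fixed points, and morphisms can be extended to `A`. The
multiplicities are constructed by downward induction on the order of the graphs. One starts with
copies of the bisets `S ×_(S, α) S`, with `α` running through representatives of `Out_F(S)`, a group
of order prime to `p`; this gives the congruence for the cardinality, which later steps do not
affect. For the inductive step, let `L` be the graph of `ψ : Q → S`. Adding an orbit with stabilizer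
`L` changes the number of fixed points of `L` by `|N(L)| / |L|`, so it is enough to know that the
numbers of fixed points for the graphs with domain `Q` agree modulo these indices. If `L₀` is the
graph of a suitable morphism from `Q` to a fully normalized subgroup, `N(L)` also acts on the fixed
points of `L₀`, by the extension axiom, and the congruence follows from Burnside's orbit counting
(`StableAbove.card_normalizer_dvd`).

*Representations.* For an `A`-representation `ρ` the representation `Λ ×_S ρ` is `F`-invariant
because `Λ` is stable, and an `A`-representation because both actions of `A` on `Λ` coincide. It
contains `ρ`, because `Λ` contains the biset `S`. A unitary form is provided by Weyl's averaging
argument (`exists_unitaryRep_equiv`).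
-/

/-! ### Subgroups of `S × S` as partial isomorphisms -/

section Relations

variable {S : Type u} [Group S]

/-- The graph of a homomorphism `φ : P → S`, with the value in the first coordinate. -/
def relGraph {P : Subgroup S} (φ : P →* S) : Subgroup (S × S) :=
  (φ.prod P.subtype).range

theorem mem_relGraph {P : Subgroup S} {φ : P →* S} {x y : S} :
    (x, y) ∈ relGraph φ ↔ ∃ h : y ∈ P, φ ⟨y, h⟩ = x := by
  constructor
  · rintro ⟨z, hz⟩
    simp only [MonoidHom.prod_apply, Subgroup.coe_subtype, Prod.mk.injEq] at hz
    obtain ⟨rfl, rfl⟩ := hz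
    exact ⟨z.2, rfl⟩
  · rintro ⟨h, rfl⟩
    exact ⟨⟨y, h⟩, rfl⟩

/-- Composition of relations on `S` which are subgroups of `S × S`. -/
def relComp (K L : Subgroup (S × S)) : Subgroup (S × S) where
  carrier := {z | ∃ y, (z.1, y) ∈ K ∧ (y, z.2) ∈ L}
  one_mem' := ⟨1, one_mem K, one_mem L⟩
  mul_mem' := by
    rintro a b ⟨y, h1, h2⟩ ⟨z, h3, h4⟩
    exact ⟨y * z, mul_mem h1 h3, mul_mem h2 h4⟩
  inv_mem' := by
    rintro a ⟨y, h1, h2⟩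
    exact ⟨y⁻¹, inv_mem h1, inv_mem h2⟩

theorem mem_relComp {K L : Subgroup (S × S)} {x z : S} :
    (x, z) ∈ relComp K L ↔ ∃ y, (x, y) ∈ K ∧ (y, z) ∈ L := Iff.rfl

/-- The converse relation. -/
def relInv (L : Subgroup (S × S)) : Subgroup (S × S) :=
  L.comap (MulEquiv.prodComm : S × S ≃* S × S).toMonoidHom

theorem mem_relInv {L : Subgroup (S × S)} {x y : S} : (x, y) ∈ relInv L ↔ (y, x) ∈ L := Iff.rfl

/-- The domain of a relation: its second projection. -/
def relDom (L : Subgroup (S × S)) : Subgroup S := L.map (MonoidHom.snd S S)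

/-- The image of a relation: its first projection. -/
def relIm (L : Subgroup (S × S)) : Subgroup S := L.map (MonoidHom.fst S S)

theorem mem_relDom {L : Subgroup (S × S)} {y : S} : y ∈ relDom L ↔ ∃ x, (x, y) ∈ L := by
  simp [relDom, Subgroup.mem_map]

theorem mem_relIm {L : Subgroup (S × S)} {x : S} : x ∈ relIm L ↔ ∃ y, (x, y) ∈ L := by
  simp [relIm, Subgroup.mem_map]

theorem relDom_mono {K L : Subgroup (S × S)} (h : K ≤ L) : relDom K ≤ relDom L :=
  Subgroup.map_mono h

theorem relDom_relInv (L : Subgroup (S × S)) : relDom (relInv L) = relIm L := by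
  ext x; simp [mem_relDom, mem_relIm, mem_relInv]

theorem relIm_relInv (L : Subgroup (S × S)) : relIm (relInv L) = relDom L := by
  ext x; simp [mem_relDom, mem_relIm, mem_relInv]

theorem relDom_relGraph {P : Subgroup S} (φ : P →* S) : relDom (relGraph φ) = P := by
  ext y
  simp only [mem_relDom, mem_relGraph]
  exact ⟨fun ⟨_, h, _⟩ => h, fun h => ⟨_, h, rfl⟩⟩

theorem relIm_relGraph {P : Subgroup S} (φ : P →* S) : relIm (relGraph φ) = φ.range := by
  ext x
  simp only [mem_relIm, mem_relGraph, MonoidHom.mem_range]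
  exact ⟨fun ⟨y, h, e⟩ => ⟨⟨y, h⟩, e⟩, fun ⟨y, e⟩ => ⟨y, y.2, e⟩⟩

theorem relDom_relComp {K L : Subgroup (S × S)} (h : relIm L ≤ relDom K) :
    relDom (relComp K L) = relDom L := by
  ext z
  simp only [mem_relDom, mem_relComp]
  constructor
  · rintro ⟨x, y, -, h2⟩
    exact ⟨y, h2⟩
  · rintro ⟨y, h2⟩
    obtain ⟨x, hx⟩ := mem_relDom.1 (h (mem_relIm.2 ⟨z, h2⟩))
    exact ⟨x, y, hx, h2⟩

theorem relIm_relComp {K L : Subgroup (S × S)} (h : relDom K ≤ relIm L) :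
    relIm (relComp K L) = relIm K := by
  ext z
  simp only [mem_relIm, mem_relComp]
  constructor
  · rintro ⟨x, y, h2, -⟩
    exact ⟨y, h2⟩
  · rintro ⟨y, h2⟩
    obtain ⟨x, hx⟩ := mem_relIm.1 (h (mem_relDom.2 ⟨z, h2⟩))
    exact ⟨x, y, h2, hx⟩

/-- The diagonal copy `{(a, a) | a ∈ A}` of `A`. -/
def diagSubgroup (A : Subgroup S) : Subgroup (S × S) := relGraph A.subtype

theorem mem_diagSubgroup {A : Subgroup S} {x y : S} :
    (x, y) ∈ diagSubgroup A ↔ y ∈ A ∧ y = x := by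
  simp [diagSubgroup, mem_relGraph]

theorem diagSubgroup_le {A : Subgroup S} {L : Subgroup (S × S)} :
    diagSubgroup A ≤ L ↔ ∀ a ∈ A, (a, a) ∈ L := by
  constructor
  · exact fun h a ha => h (mem_diagSubgroup.2 ⟨ha, rfl⟩)
  · rintro h ⟨x, y⟩ hxy
    obtain ⟨hy, rfl⟩ := mem_diagSubgroup.1 hxy
    exact h _ hy

theorem mem_normalizer_iff_pairs {L : Subgroup (S × S)} {s t : S} :
    (s, t) ∈ Subgroup.normalizer (L : Set (S × S)) ↔
      ∀ x y, (x, y) ∈ L ↔ (s * x * s⁻¹, t * y * t⁻¹) ∈ L := by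
  rw [Subgroup.mem_normalizer_iff]
  exact ⟨fun h x y => h (x, y), fun h z => h z.1 z.2⟩

end Relations

/-! ### Fusion systems in terms of graphs -/

namespace FusionSystem

variable {S : Type u} [Group S] (F : FusionSystem S)

/-- The graphs of the morphisms of `F`. Working with these subgroups of `S × S` instead of the
morphisms turns composition, inversion and restriction into operations on subgroups. -/
def graphs : Set (Subgroup (S × S)) :=
  {L | ∃ (P : Subgroup S), ∃ φ ∈ F.HomS P, L = relGraph φ}

variable {F}

theorem relGraph_mem_graphs {P : Subgroup S} {φ : P →* S} (hφ : φ ∈ F.HomS P) :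
    relGraph φ ∈ F.graphs := ⟨P, φ, hφ, rfl⟩

theorem graphs_functional {L : Subgroup (S × S)} (hL : L ∈ F.graphs) {x x' y : S}
    (h : (x, y) ∈ L) (h' : (x', y) ∈ L) : x = x' := by
  obtain ⟨P, φ, hφ, rfl⟩ := hL
  obtain ⟨_, rfl⟩ := mem_relGraph.1 h
  obtain ⟨_, rfl⟩ := mem_relGraph.1 h'
  rfl

theorem subtype_comp_mem_HomS {P Q : Subgroup S} {φ : P →* Q} (hφ : φ ∈ F.Hom P Q) :
    Q.subtype.comp φ ∈ F.HomS P :=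
  F.comp_mem hφ (F.conj_mem (Subgroup.inclusion le_top) 1 (by simp))

theorem HomS.comp_inclusion {P Q : Subgroup S} {φ : Q →* S} (hφ : φ ∈ F.HomS Q) (h : P ≤ Q) :
    φ.comp (Subgroup.inclusion h) ∈ F.HomS P :=
  F.comp_mem (F.conj_mem (Subgroup.inclusion h) 1 (by simp)) hφ

theorem HomS.exists_equiv {P : Subgroup S} {φ : P →* S} (hφ : φ ∈ F.HomS P) :
    ∃ e : P ≃* φ.range, (∀ x, (e x : S) = φ x) ∧ e.toMonoidHom ∈ F.Hom P φ.range ∧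
      e.symm.toMonoidHom ∈ F.Hom φ.range P := by
  obtain ⟨R, hR, e, h1, h2, h3⟩ := F.factor hφ
  have h4 : ∀ x, (e x : S) = φ x := fun x => by
    have := congrArg Subtype.val (DFunLike.congr_fun h3 x)
    exact this.symm
  have h5 : R = φ.range := by
    ext y
    constructor
    · intro hy
      obtain ⟨x, hx⟩ := e.surjective ⟨y, hy⟩
      exact ⟨x, by rw [← h4, hx]⟩
    · rintro ⟨x, rfl⟩
      rw [← h4]
      exact (e x).2
  subst h5
  exact ⟨e, h4, h1, h2⟩

theorem HomS.codRestrict_mem {P Q : Subgroup S} {φ : P →* S} (hφ : φ ∈ F.HomS P)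
    (h : ∀ x, φ x ∈ Q) : φ.codRestrict Q h ∈ F.Hom P Q := by
  obtain ⟨e, h1, h2, -⟩ := HomS.exists_equiv hφ
  have hle : φ.range ≤ Q := by rintro _ ⟨x, rfl⟩; exact h x
  have := F.comp_mem h2 (F.conj_mem (Subgroup.inclusion hle) 1 (by simp))
  convert this using 1
  ext x
  exact (h1 x).symm

theorem relGraph_mem_graphs_iff {P : Subgroup S} {φ : P →* S} :
    relGraph φ ∈ F.graphs ↔ φ ∈ F.HomS P := by
  refine ⟨?_, relGraph_mem_graphs⟩
  rintro ⟨Q, ψ, hψ, h⟩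
  have h1 : P = Q := by rw [← relDom_relGraph φ, h, relDom_relGraph]
  subst h1
  have h2 : φ = ψ := by
    ext y
    have h3 : (φ y, (y : S)) ∈ relGraph ψ := h ▸ mem_relGraph.2 ⟨y.2, rfl⟩
    exact (mem_relGraph.1 h3).2.symm
  exact h2 ▸ hψ

theorem graphs_mono {K L : Subgroup (S × S)} (hL : L ∈ F.graphs) (h : K ≤ L) : K ∈ F.graphs := by
  obtain ⟨P, φ, hφ, rfl⟩ := hL
  have hP : relDom K ≤ P := by
    have := relDom_mono h
    rwa [relDom_relGraph] at this
  refine ⟨relDom K, φ.comp (Subgroup.inclusion hP), HomS.comp_inclusion hφ hP, ?_⟩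
  ext ⟨x, y⟩
  rw [mem_relGraph]
  constructor
  · intro hxy
    obtain ⟨_, e⟩ := mem_relGraph.1 (h hxy)
    exact ⟨mem_relDom.2 ⟨x, hxy⟩, e⟩
  · rintro ⟨hy, rfl⟩
    obtain ⟨x, hx⟩ := mem_relDom.1 hy
    obtain ⟨_, e⟩ := mem_relGraph.1 (h hx)
    subst e
    exact hx

theorem relInv_mem_graphs {L : Subgroup (S × S)} (hL : L ∈ F.graphs) : relInv L ∈ F.graphs := by
  obtain ⟨P, φ, hφ, rfl⟩ := hL
  obtain ⟨e, h1, -, h2⟩ := HomS.exists_equiv hφ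
  refine ⟨φ.range, _, subtype_comp_mem_HomS h2, ?_⟩
  ext ⟨x, y⟩
  rw [mem_relInv, mem_relGraph, mem_relGraph]
  constructor
  · rintro ⟨hx, rfl⟩
    refine ⟨⟨_, rfl⟩, ?_⟩
    have : (⟨φ ⟨x, hx⟩, ⟨_, rfl⟩⟩ : φ.range) = e ⟨x, hx⟩ := Subtype.ext (h1 _).symm
    simp [this]
  · rintro ⟨⟨z, rfl⟩, rfl⟩
    have : (⟨φ z, ⟨_, rfl⟩⟩ : φ.range) = e z := Subtype.ext (h1 _).symm
    simp [this]

theorem relComp_mem_graphs {K L : Subgroup (S × S)} (hK : K ∈ F.graphs) (hL : L ∈ F.graphs) :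
    relComp K L ∈ F.graphs := by
  have hK' := hK
  obtain ⟨Q, ψ, hψ, rfl⟩ := hK
  -- the part of `L` with image in the domain of `K` is the graph of a morphism into `Q`
  have hL' : L ⊓ Q.comap (MonoidHom.fst S S) ∈ F.graphs := graphs_mono hL inf_le_left
  obtain ⟨P, φ, hφ, h⟩ := hL'
  have hQ : ∀ x, φ x ∈ Q := fun x => by
    have : (φ x, (x : S)) ∈ L ⊓ Q.comap (MonoidHom.fst S S) := h ▸ mem_relGraph.2 ⟨x.2, rfl⟩
    exact this.2
  refine ⟨P, ψ.comp (φ.codRestrict Q hQ), F.comp_mem (HomS.codRestrict_mem hφ hQ) hψ, ?_⟩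
  ext ⟨x, z⟩
  rw [mem_relComp, mem_relGraph]
  constructor
  · rintro ⟨y, h1, h2⟩
    obtain ⟨hy, rfl⟩ := mem_relGraph.1 h1
    have h3 : (y, z) ∈ relGraph φ := h ▸ ⟨h2, hy⟩
    obtain ⟨hz, rfl⟩ := mem_relGraph.1 h3
    exact ⟨hz, rfl⟩
  · rintro ⟨hz, rfl⟩
    refine ⟨φ ⟨z, hz⟩, mem_relGraph.2 ⟨hQ _, rfl⟩, ?_⟩
    have : (φ ⟨z, hz⟩, z) ∈ L ⊓ Q.comap (MonoidHom.fst S S) := h ▸ mem_relGraph.2 ⟨hz, rfl⟩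
    exact this.1

/-- The graph of conjugation by `s` on `S`. -/
theorem relGraph_conj_mem_graphs (s : S) :
    relGraph ((MulAut.conj s).toMonoidHom.comp (⊤ : Subgroup S).subtype) ∈ F.graphs :=
  relGraph_mem_graphs (F.conj_mem _ s fun _ => rfl)

theorem graphs_of_conj {K L : Subgroup (S × S)} (hL : L ∈ F.graphs) (s t : S)
    (h : ∀ x y, (x, y) ∈ K → (s * x * s⁻¹, t * y * t⁻¹) ∈ L) : K ∈ F.graphs := by
  refine graphs_mono (relComp_mem_graphs (relGraph_conj_mem_graphs s⁻¹)
    (relComp_mem_graphs hL (relGraph_conj_mem_graphs t))) ?_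
  rintro ⟨x, y⟩ hxy
  refine mem_relComp.2 ⟨s * x * s⁻¹, mem_relGraph.2 ⟨trivial, ?_⟩,
    mem_relComp.2 ⟨t * y * t⁻¹, h x y hxy, mem_relGraph.2 ⟨trivial, rfl⟩⟩⟩
  simp [mul_assoc]

theorem diagSubgroup_mem_graphs (A : Subgroup S) : diagSubgroup A ∈ F.graphs :=
  relGraph_mem_graphs (F.conj_mem _ 1 (by simp))

theorem card_relDom {L : Subgroup (S × S)} (hL : L ∈ F.graphs) :
    Nat.card (relDom L) = Nat.card L := by
  symm
  refine Nat.card_congr (Equiv.ofBijective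
    (fun z : L => (⟨z.1.2, mem_relDom.2 ⟨z.1.1, z.2⟩⟩ : relDom L)) ⟨?_, ?_⟩)
  · rintro ⟨⟨x, y⟩, h⟩ ⟨⟨x', y'⟩, h'⟩ e
    obtain rfl : y = y' := congrArg Subtype.val e
    obtain rfl := graphs_functional hL h h'
    rfl
  · rintro ⟨y, hy⟩
    obtain ⟨x, hx⟩ := mem_relDom.1 hy
    exact ⟨⟨(x, y), hx⟩, rfl⟩

theorem card_relIm {L : Subgroup (S × S)} (hL : L ∈ F.graphs) :
    Nat.card (relIm L) = Nat.card L := by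
  rw [← relDom_relInv, card_relDom (relInv_mem_graphs hL)]
  exact Nat.card_congr
    ⟨fun z => ⟨(z.1.2, z.1.1), z.2⟩, fun z => ⟨(z.1.2, z.1.1), z.2⟩, fun _ => rfl, fun _ => rfl⟩

theorem isConj_iff {P Q : Subgroup S} :
    F.IsConj P Q ↔ ∃ L ∈ F.graphs, relDom L = P ∧ relIm L = Q := by
  constructor
  · rintro ⟨e, h1, -⟩
    refine ⟨_, relGraph_mem_graphs (subtype_comp_mem_HomS h1), relDom_relGraph _, ?_⟩
    rw [relIm_relGraph]
    ext y
    constructor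
    · rintro ⟨x, rfl⟩
      exact (e x).2
    · intro hy
      exact ⟨e.symm ⟨y, hy⟩, by simp⟩
  · rintro ⟨_, ⟨P, φ, hφ, rfl⟩, rfl, rfl⟩
    obtain ⟨e, -, h2, h3⟩ := HomS.exists_equiv hφ
    rw [relDom_relGraph, relIm_relGraph]
    exact ⟨e, h2, h3⟩

theorem IsConj.symm {P Q : Subgroup S} (h : F.IsConj P Q) : F.IsConj Q P :=
  let ⟨e, h1, h2⟩ := h
  ⟨e.symm, h2, h1⟩

theorem IsConj.trans {P Q R : Subgroup S} (h : F.IsConj P Q) (h' : F.IsConj Q R) :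
    F.IsConj P R :=
  let ⟨e, h1, h2⟩ := h
  let ⟨e', h1', h2'⟩ := h'
  ⟨e.trans e', F.comp_mem h1 h1', F.comp_mem h2' h2⟩

theorem IsConj.refl (P : Subgroup S) : F.IsConj P P :=
  ⟨MulEquiv.refl P, F.conj_mem _ 1 (by simp), F.conj_mem _ 1 (by simp)⟩

theorem exists_fullyNormalized [Finite S] (P : Subgroup S) :
    ∃ Q, F.IsConj P Q ∧ F.FullyNormalized Q := by
  obtain ⟨Q, hQ, hmax⟩ := Set.exists_max_image {Q | F.IsConj P Q}
    (fun Q => Nat.card (Subgroup.normalizer (Q : Set S))) (Set.toFinite _) ⟨P, IsConj.refl P⟩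
  exact ⟨Q, hQ, fun R hR => hmax R (IsConj.trans hQ hR)⟩

/-- The extension axiom in terms of graphs: the extension domain of a morphism is the second
projection of the normalizer of its graph. -/
theorem IsSaturated.exists_graph_extension {p : ℕ} (hF : F.IsSaturated p)
    {L : Subgroup (S × S)} (hL : L ∈ F.graphs) (hc : F.FullyCentralized (relIm L)) :
    ∃ L' ∈ F.graphs, L ≤ L' ∧
      ∀ s t, (s, t) ∈ Subgroup.normalizer (L : Set (S × S)) → t ∈ relDom L' := by
  obtain ⟨P, φ, hφ, rfl⟩ := hL
  rw [relIm_relGraph] at hc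
  obtain ⟨ψ, hψ, hext⟩ := hF.extend P φ hφ hc
  refine ⟨_, relGraph_mem_graphs hψ, ?_, ?_⟩
  · rintro ⟨x, y⟩ hxy
    obtain ⟨hy, rfl⟩ := mem_relGraph.1 hxy
    exact mem_relGraph.2 ⟨le_extensionDomain φ _ hy, DFunLike.congr_fun hext ⟨y, hy⟩⟩
  · intro s t hst
    rw [relDom_relGraph]
    rw [mem_normalizer_iff_pairs] at hst
    have ht : t ∈ Subgroup.normalizer (P : Set S) := by
      rw [Subgroup.mem_normalizer_iff]
      intro y
      constructor
      · intro hy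
        exact (mem_relGraph.1 ((hst (φ ⟨y, hy⟩) y).1 (mem_relGraph.2 ⟨hy, rfl⟩))).1
      · intro hy
        refine (mem_relGraph.1 ((hst (s⁻¹ * φ ⟨_, hy⟩ * s) y).2 (mem_relGraph.2 ⟨hy, ?_⟩))).1
        simp [mul_assoc]
    have hs : s ∈ Subgroup.normalizer (φ.range : Set S) := by
      rw [Subgroup.mem_normalizer_iff]
      intro x
      rw [← relIm_relGraph, mem_relIm, mem_relIm]
      constructor
      · rintro ⟨y, hy⟩
        exact ⟨_, (hst x y).1 hy⟩
      · rintro ⟨y, hy⟩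
        refine ⟨t⁻¹ * y * t, (hst x _).2 ?_⟩
        simpa [mul_assoc] using hy
    refine ⟨⟨t, ht⟩, ⟨⟨s, hs⟩, ?_⟩, rfl⟩
    ext z
    obtain ⟨y, rfl⟩ := (MonoidHom.ofInjective (HomS.injective F hφ)).surjective z
    obtain ⟨hy, e⟩ := mem_relGraph.1
      ((hst (φ y) y).1 (mem_relGraph.2 ⟨y.2, rfl⟩))
    have h1 : (P.normalizerMonoidHom ⟨t, ht⟩) y = ⟨t * y * t⁻¹, hy⟩ := Subtype.ext rfl
    have h2 : ((φ.range.normalizerMonoidHom ⟨s, hs⟩)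
      (MonoidHom.ofInjective (HomS.injective F hφ) y) : S) = s * φ y * s⁻¹ := rfl
    rw [h2, ← e]
    simp only [MulAut.congr, MulEquiv.toMonoidHom_eq_coe, MonoidHom.coe_comp, Function.comp_apply]
    simp [h1]
    rfl

end FusionSystem

/-! ### Consequences of saturation -/

theorem mem_normalizer_of_pairs {S : Type u} [Group S] [Finite S] {L : Subgroup (S × S)} {s t : S}
    (h : ∀ x y, (x, y) ∈ L → (s * x * s⁻¹, t * y * t⁻¹) ∈ L) :
    (s, t) ∈ Subgroup.normalizer (L : Set (S × S)) :=
  Subgroup.mem_normalizer_fintype fun z hz => h z.1 z.2 hz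

namespace FusionSystem

variable {S : Type u} [Group S] {F : FusionSystem S}

/-- A consequence of the Sylow axiom: among the isomorphisms in `F` from `P` to a fully normalized
subgroup, one carries `Aut_S(P)` into `Aut_S(Q)`. -/
theorem IsSaturated.exists_graph_of_fullyNormalized [Finite S] {p : ℕ} [Fact p.Prime]
    (hS : IsPGroup p S) (hF : F.IsSaturated p) {P Q : Subgroup S} (hPQ : F.IsConj P Q)
    (hQ : F.FullyNormalized Q) :
    ∃ L ∈ F.graphs, relDom L = P ∧ relIm L = Q ∧
      ∀ t ∈ Subgroup.normalizer (P : Set S),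
        ∃ s, (s, t) ∈ Subgroup.normalizer (L : Set (S × S)) := by
  obtain ⟨e, he, he'⟩ := hPQ
  obtain ⟨T, hT⟩ := hF.sylow Q hQ
  have hPA : IsPGroup p (autS P) :=
    (hS.to_subgroup _).of_surjective _ P.normalizerMonoidHom.rangeRestrict_surjective
  have hH : IsPGroup p (((autS P).map (MulAut.congr e).toMonoidHom).subgroupOf (F.autF Q)) :=
    (hPA.map _).comap_of_injective _ (Subgroup.subtype_injective _)
  have : Finite (MulAut Q) := Finite.of_injective (fun f : MulAut Q => (f : Q → Q))
    DFunLike.coe_injective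
  obtain ⟨T', hT'⟩ := hH.exists_le_sylow
  obtain ⟨β, hβ⟩ := MulAction.exists_smul_eq (F.autF Q) T' T
  have hcong : ∀ a ∈ autS P, MulAut.congr e a ∈ F.autF Q := by
    have hmem : ∀ a ∈ autS P, (MulEquiv.toMonoidHom (MulAut.congr e a)) ∈ F.Hom Q Q := by
      rintro _ ⟨t, rfl⟩
      exact F.comp_mem (F.comp_mem he' (F.conj_mem
        (MulEquiv.toMonoidHom (P.normalizerMonoidHom t)) t (fun _ => rfl))) he
    intro a ha
    refine ⟨hmem a ha, ?_⟩
    rw [← map_inv]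
    exact hmem _ (inv_mem ha)
  refine ⟨_, relGraph_mem_graphs (subtype_comp_mem_HomS (F.comp_mem he β.2.1)),
    relDom_relGraph _, ?_, ?_⟩
  · rw [relIm_relGraph]
    ext y
    constructor
    · rintro ⟨x, rfl⟩
      exact SetLike.coe_mem _
    · intro hy
      refine ⟨e.symm (β.1.symm ⟨y, hy⟩), ?_⟩
      simp
  · intro t ht
    have ha : P.normalizerMonoidHom ⟨t, ht⟩ ∈ autS P := ⟨_, rfl⟩
    set a := P.normalizerMonoidHom ⟨t, ht⟩ with ha_def
    have h1 : (⟨_, hcong a ha⟩ : F.autF Q) ∈ (T' : Subgroup (F.autF Q)) :=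
      hT' (Subgroup.mem_subgroupOf.2 ⟨a, ha, rfl⟩)
    have h2 : β * ⟨_, hcong a ha⟩ * β⁻¹ ∈ (T : Subgroup (F.autF Q)) := by
      rw [← hβ, Sylow.coe_subgroup_smul]
      exact Subgroup.smul_mem_pointwise_smul _ (MulAut.conj β) _ h1
    rw [hT, Subgroup.mem_subgroupOf] at h2
    obtain ⟨⟨s, hs⟩, h3⟩ := h2
    refine ⟨s, mem_normalizer_of_pairs ?_⟩
    intro x y hxy
    obtain ⟨hy, rfl⟩ := mem_relGraph.1 hxy
    refine mem_relGraph.2 ⟨((Subgroup.mem_normalizer_iff.1 ht) y).1 hy, ?_⟩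
    have h4 := congrArg Subtype.val (DFunLike.congr_fun h3 (β.1 (e ⟨y, hy⟩)))
    have h5 : (a ⟨y, hy⟩ : P) = ⟨t * y * t⁻¹, ((Subgroup.mem_normalizer_iff.1 ht) y).1 hy⟩ :=
      Subtype.ext rfl
    have h6 : ((Q.normalizerMonoidHom ⟨s, hs⟩ (β.1 (e ⟨y, hy⟩)) : Q) : S)
      = s * (β.1 (e ⟨y, hy⟩)) * s⁻¹ := rfl
    rw [h6] at h4
    simp [MulAut.congr, h5] at h4
    simpa using h4.symm

/-- Every subgroup `P` has an isomorphism in `F` to any given fully normalized conjugate which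
extends to the normalizer of `P`. -/
theorem IsSaturated.exists_graph_of_fullyNormalized_extension [Finite S] {p : ℕ} [Fact p.Prime]
    (hS : IsPGroup p S) (hF : F.IsSaturated p) {P Q : Subgroup S} (hPQ : F.IsConj P Q)
    (hQ : F.FullyNormalized Q) :
    ∃ L ∈ F.graphs, relDom L = P ∧ relIm L = Q ∧
      ∃ L' ∈ F.graphs, L ≤ L' ∧ Subgroup.normalizer (P : Set S) ≤ relDom L' := by
  obtain ⟨L, hL, h1, h2, h3⟩ := hF.exists_graph_of_fullyNormalized hS hPQ hQ
  obtain ⟨L', hL', h4, h5⟩ := hF.exists_graph_extension hL (h2 ▸ hF.fullyCentralized Q hQ)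
  exact ⟨L, hL, h1, h2, L', hL', h4, fun t ht => let ⟨s, hs⟩ := h3 t ht; h5 s t hs⟩

theorem card_center_eq_of_isConj {P Q : Subgroup S} (h : F.IsConj P Q) :
    Nat.card (Subgroup.center P) = Nat.card (Subgroup.center Q) := by
  obtain ⟨e, -⟩ := h
  exact Nat.card_congr (Subgroup.centerCongr e).toEquiv

/-- A fully centralized conjugate of a subgroup which is not centric does not contain its
centralizer: its center has the same order as those of its conjugates, and its centralizer is at
least as large as theirs. -/
theorem not_centralizer_le_of_not_isCentric [Finite S] {P Q : Subgroup S} (hPQ : F.IsConj P Q)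
    (hQ : F.FullyCentralized Q) (hP : ¬ F.IsCentric P) :
    ¬ Subgroup.centralizer (Q : Set S) ≤ Q := by
  intro hle
  simp only [IsCentric, not_forall] at hP
  obtain ⟨R, hR, hRle⟩ := hP
  refine hRle ?_
  have hQR : F.IsConj Q R := IsConj.trans (IsConj.symm hPQ) hR
  have key : ∀ U : Subgroup S, (Subgroup.center U).map U.subtype =
      Subgroup.centralizer (U : Set S) ⊓ U := by
    intro U
    ext x
    simp only [Subgroup.mem_map, Subgroup.mem_inf, Subgroup.mem_centralizer_iff,
      Subgroup.mem_center_iff]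
    constructor
    · rintro ⟨y, hy, rfl⟩
      exact ⟨fun z hz => congrArg Subtype.val (hy ⟨z, hz⟩), y.2⟩
    · rintro ⟨h1, h2⟩
      exact ⟨⟨x, h2⟩, fun z => Subtype.ext (h1 z z.2), rfl⟩
  have key' : ∀ U : Subgroup S, Nat.card (Subgroup.center U) =
      Nat.card (Subgroup.centralizer (U : Set S) ⊓ U : Subgroup S) := fun U => by
    rw [← key U, Subgroup.card_map_of_injective (Subgroup.subtype_injective _)]
  have h1 := card_center_eq_of_isConj hQR
  rw [key', key', inf_eq_left.2 hle] at h1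
  have h2 := hQ R hQR
  rw [h1] at h2
  have h3 := Subgroup.eq_of_le_of_card_ge (inf_le_left :
    Subgroup.centralizer (R : Set S) ⊓ R ≤ _) h2
  exact inf_eq_left.1 h3

theorem isCentric_top [Finite S] : F.IsCentric ⊤ := by
  rintro Q ⟨e, -⟩
  have : Q = ⊤ := Subgroup.eq_top_of_card_eq _ (by
    rw [← Nat.card_congr e.toEquiv, Subgroup.card_top])
  rw [this]
  exact le_top

theorem lt_normalizer [Finite S] {p : ℕ} [Fact p.Prime] (hS : IsPGroup p S) {P : Subgroup S}
    (hP : P ≠ ⊤) : P < Subgroup.normalizer (P : Set S) := by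
  have := hS.isNilpotent
  exact Group.normalizerCondition_of_isNilpotent P (lt_top_iff_ne_top.2 hP)

/-- A subgroup which is central in `F` can be added to the domain of every morphism. The proof is
by induction on the index of the domain, and follows the one of Alperin's fusion theorem: a
morphism whose domain is not centric is a composite of morphisms which extend to larger domains. -/
theorem IsSaturated.exists_graph_extension_center [Finite S] {p : ℕ} [Fact p.Prime]
    (hS : IsPGroup p S) (hF : F.IsSaturated p) {A : Subgroup S} (hA : A ≤ F.center)
    {L : Subgroup (S × S)} (hL : L ∈ F.graphs) :
    ∃ L' ∈ F.graphs, L ≤ L' ∧ diagSubgroup A ≤ L' := by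
  induction hn : Nat.card S - Nat.card L using Nat.strong_induction_on generalizing L with
  | _ n ih =>
  have hle : ∀ K ∈ F.graphs, Nat.card K ≤ Nat.card S := fun K hK => by
    rw [← card_relDom hK]
    exact Subgroup.card_le_card_group _
  by_cases hc : F.IsCentric (relDom L)
  · refine ⟨L, hL, le_rfl, diagSubgroup_le.2 fun a ha => ?_⟩
    obtain ⟨P, φ, hφ, rfl⟩ := hL
    rw [relDom_relGraph] at hc
    obtain ⟨hz, h⟩ := (hA ha).2 P ⊤ hc isCentric_top _ hφ
    exact mem_relGraph.2 ⟨hz, h⟩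
  · obtain ⟨Q, hPQ, hQ⟩ := F.exists_fullyNormalized (relDom L)
    have hQc := hF.fullyCentralized Q hQ
    have hPR : F.IsConj (relDom L) (relIm L) := isConj_iff.2 ⟨L, hL, rfl, rfl⟩
    have hne : ∀ R, F.IsConj (relDom L) R → R ≠ ⊤ := by
      rintro R hR rfl
      exact hc fun U hU => isCentric_top U (IsConj.trans (IsConj.symm hR) hU)
    have hcard : ∀ R, F.IsConj (relDom L) R → Nat.card R = Nat.card (relDom L) := by
      rintro R ⟨e, -⟩
      exact (Nat.card_congr e.toEquiv).symm
    -- enlarging the domain of a morphism defined on a conjugate of the domain of `L`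
    have step' : ∀ R, F.IsConj (relDom L) R → ∀ K ∈ F.graphs, R < relDom K →
        ∃ L' ∈ F.graphs, K ≤ L' ∧ diagSubgroup A ≤ L' := by
      intro R hR K hK hlt
      have h1 : Nat.card L < Nat.card K := by
        rw [← card_relDom hK, ← card_relDom hL, ← hcard R hR]
        exact Set.ncard_lt_ncard hlt (Set.toFinite _)
      have h2 := hle K hK
      exact ih _ (by omega) hK rfl
    have ext : ∀ R, F.IsConj (relDom L) R → ∃ K ∈ F.graphs, relDom K = R ∧ relIm K = Q ∧
        ∃ K' ∈ F.graphs, K ≤ K' ∧ diagSubgroup A ≤ K' := by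
      intro R hR
      obtain ⟨K, hK, h1, h2, K', hK', h3, h4⟩ := hF.exists_graph_of_fullyNormalized_extension hS
        (IsConj.trans (IsConj.symm hR) hPQ) hQ
      obtain ⟨K'', h5, h6, h7⟩ := step' R hR K' hK' ((lt_normalizer hS (hne R hR)).trans_le h4)
      exact ⟨K, hK, h1, h2, K'', h5, h3.trans h6, h7⟩
    obtain ⟨L₁, hL₁, hd₁, hi₁, K₁, hK₁, hLK₁, hA₁⟩ := ext _ (IsConj.refl _)
    obtain ⟨L₂, hL₂, hd₂, hi₂, K₂, hK₂, hLK₂, hA₂⟩ := ext _ hPR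
    -- the automorphism of `Q` corresponding to `L`
    set α := relComp L₂ (relComp L (relInv L₁)) with hα
    have hαm : α ∈ F.graphs :=
      relComp_mem_graphs hL₂ (relComp_mem_graphs hL (relInv_mem_graphs hL₁))
    have hαi' : relIm (relComp L (relInv L₁)) = relIm L :=
      relIm_relComp (by rw [relIm_relInv, hd₁])
    have hαi : relIm α = Q := by
      rw [hα, relIm_relComp (by rw [hαi', hd₂]), hi₂]
    have hαd : relDom α = Q := by
      rw [hα, relDom_relComp (by rw [hαi', hd₂]), relDom_relComp (by rw [relIm_relInv, hd₁]),
        relDom_relInv, hi₁]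
    obtain ⟨α', hα', hαα', hN⟩ := hF.exists_graph_extension hαm (hαi ▸ hQc)
    have hlt : Q < relDom α' := by
      have h1 : Q ≤ relDom α' := hαd ▸ relDom_mono hαα'
      refine lt_of_le_of_ne h1 fun heq => ?_
      refine not_centralizer_le_of_not_isCentric hPQ hQc hc ?_
      intro c hcc
      rw [heq]
      refine hN 1 c (mem_normalizer_of_pairs fun x y hxy => ?_)
      have hy : y ∈ Q := hαd ▸ mem_relDom.2 ⟨x, hxy⟩
      have : y * c = c * y := Subgroup.mem_centralizer_iff.1 hcc y hy
      rw [← this]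
      simpa using hxy
    obtain ⟨K₃, hK₃, hαK₃, hA₃⟩ := step' Q hPQ α' hα' hlt
    refine ⟨relComp (relInv K₂) (relComp K₃ K₁), relComp_mem_graphs (relInv_mem_graphs hK₂)
      (relComp_mem_graphs hK₃ hK₁), ?_, ?_⟩
    · rintro ⟨x, y⟩ hxy
      obtain ⟨x', hx'⟩ := mem_relDom.1 (hd₂ ▸ mem_relIm.2 ⟨y, hxy⟩ : x ∈ relDom L₂)
      obtain ⟨y', hy'⟩ := mem_relDom.1 (hd₁ ▸ mem_relDom.2 ⟨x, hxy⟩ : y ∈ relDom L₁)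
      exact ⟨x', hLK₂ hx', y', hαK₃ (hαα' ⟨x, hx', y, hxy, hy'⟩), hLK₁ hy'⟩
    · rw [diagSubgroup_le] at hA₁ hA₂ hA₃ ⊢
      exact fun a ha => ⟨a, hA₂ a ha, a, hA₃ a ha, hA₁ a ha⟩

/-- Morphisms defined on a central subgroup `A` restrict to the identity of `A`. -/
theorem IsSaturated.diagSubgroup_le_of_le_relDom [Finite S] {p : ℕ} [Fact p.Prime]
    (hS : IsPGroup p S) (hF : F.IsSaturated p) {A : Subgroup S} (hA : A ≤ F.center)
    {L : Subgroup (S × S)} (hL : L ∈ F.graphs) (h : A ≤ relDom L) : diagSubgroup A ≤ L := by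
  obtain ⟨L', hL', h1, h2⟩ := hF.exists_graph_extension_center hS hA hL
  rw [diagSubgroup_le] at h2 ⊢
  intro a ha
  obtain ⟨x, hx⟩ := mem_relDom.1 (h ha)
  exact graphs_functional hL' (h1 hx) (h2 a ha) ▸ hx

end FusionSystem

/-! ### Fixed points of finite group actions -/

section GSets

theorem smul_eq_smul_iff_inv_mul_mem_stabilizer {K X : Type*} [Group K] [MulAction K X]
    (a b : K) (x : X) : a • x = b • x ↔ b⁻¹ * a ∈ MulAction.stabilizer K x := by
  rw [MulAction.mem_stabilizer_iff, mul_smul, inv_smul_eq_iff]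

/-- Two orbits with the same stabilizer are isomorphic. -/
theorem exists_bijOn_orbit {K X Y : Type*} [Group K] [MulAction K X] [MulAction K Y] {x : X}
    {y : Y} (h : MulAction.stabilizer K x = MulAction.stabilizer K y) :
    ∃ g : X → Y, Set.BijOn g (MulAction.orbit K x) (MulAction.orbit K y) ∧
      ∀ (k : K), ∀ z ∈ MulAction.orbit K x, g (k • z) = k • g z := by
  classical
  have key : ∀ a b : K, a • x = b • x ↔ a • y = b • y := fun a b => by
    rw [smul_eq_smul_iff_inv_mul_mem_stabilizer, h, ← smul_eq_smul_iff_inv_mul_mem_stabilizer]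
  let g : X → Y := fun z => if hz : ∃ k : K, k • x = z then hz.choose • y else y
  have hg : ∀ k : K, g (k • x) = k • y := fun k => by
    have hz : ∃ k' : K, k' • x = k • x := ⟨k, rfl⟩
    simp only [g, dif_pos hz]
    exact (key _ _).1 hz.choose_spec
  refine ⟨g, ⟨?_, ?_, ?_⟩, ?_⟩
  · rintro _ ⟨k, rfl⟩
    exact ⟨k, (hg k).symm⟩
  · rintro _ ⟨k, rfl⟩ _ ⟨k', rfl⟩ he
    simp only [hg] at he
    exact (key _ _).2 he
  · rintro _ ⟨k, rfl⟩
    exact ⟨k • x, ⟨k, rfl⟩, hg k⟩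
  · rintro k _ ⟨k', rfl⟩
    simp only [hg, ← mul_smul]

theorem smul_mem_orbit_of_mem_orbit {K X : Type*} [Group K] [MulAction K X] {x z : X} (k : K)
    (hz : z ∈ MulAction.orbit K x) : k • z ∈ MulAction.orbit K x := by
  obtain ⟨k', rfl⟩ := hz
  exact ⟨k * k', mul_smul _ _ _⟩

theorem smul_mem_diff_orbit {K X : Type*} [Group K] [MulAction K X] {x : X} {U : Set X}
    (hU : ∀ (k : K), ∀ z ∈ U, k • z ∈ U) (k : K) (z : X) (hz : z ∈ U \ MulAction.orbit K x) :
    k • z ∈ U \ MulAction.orbit K x := by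
  refine ⟨hU k z hz.1, fun hc => hz.2 ?_⟩
  have := smul_mem_orbit_of_mem_orbit k⁻¹ hc
  rwa [inv_smul_smul] at this

theorem ncard_fixed_diff_orbit {K X : Type*} [Group K] [MulAction K X] [Finite X] {x : X}
    {U : Set X} (hU : MulAction.orbit K x ⊆ U) (H : Subgroup K) :
    {z ∈ U \ MulAction.orbit K x | ∀ k ∈ H, k • z = z}.ncard +
      {z ∈ MulAction.orbit K x | ∀ k ∈ H, k • z = z}.ncard =
      {z ∈ U | ∀ k ∈ H, k • z = z}.ncard := by
  rw [← Set.ncard_union_eq ?_ (Set.toFinite _) (Set.toFinite _)]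
  · congr 1
    ext z
    have := @hU z
    change ((z ∈ U ∧ z ∉ _) ∧ _) ∨ (z ∈ _ ∧ _) ↔ z ∈ U ∧ _
    tauto
  · rw [Set.disjoint_left]
    exact fun z hz hz' => hz.1.2 hz'.1

/-- Finite sets with an action of `K` are determined up to isomorphism by the numbers of their
fixed points under the subgroups of `K`. This version is about invariant subsets, which allows
an induction that removes one orbit at a time. -/
theorem exists_equivariant_bijOn {K X Y : Type*} [Group K] [Finite K] [Finite X]
    [Finite Y] [Nonempty Y] [MulAction K X] [MulAction K Y] (U : Set X) (V : Set Y)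
    (hU : ∀ (k : K), ∀ x ∈ U, k • x ∈ U) (hV : ∀ (k : K), ∀ y ∈ V, k • y ∈ V)
    (h : ∀ H : Subgroup K, {x ∈ U | ∀ k ∈ H, k • x = x}.ncard =
      {y ∈ V | ∀ k ∈ H, k • y = y}.ncard) :
    ∃ f : X → Y, Set.BijOn f U V ∧ ∀ (k : K), ∀ x ∈ U, f (k • x) = k • f x := by
  classical
  induction hn : U.ncard using Nat.strong_induction_on generalizing U V with
  | _ n ih =>
  rcases U.eq_empty_or_nonempty with rfl | ⟨x₁, hx₁⟩
  · have h1 := h ⊥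
    have h2 : {y ∈ V | ∀ k ∈ (⊥ : Subgroup K), k • y = y} = V := by
      ext y; simp [Subgroup.mem_bot]
    have h3 : {x ∈ (∅ : Set X) | ∀ k ∈ (⊥ : Subgroup K), k • x = x} = ∅ := by
      ext y; simp
    rw [h2, h3, Set.ncard_empty] at h1
    obtain rfl : V = ∅ := (Set.ncard_eq_zero (Set.toFinite _)).1 h1.symm
    exact ⟨fun _ => Classical.arbitrary Y, by simp, by simp⟩
  · -- a point of `U` with maximal stabilizer, and the corresponding point of `V`
    obtain ⟨x, hx, hmax⟩ := Set.exists_max_image U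
      (fun x => Nat.card (MulAction.stabilizer K x)) (Set.toFinite _) ⟨x₁, hx₁⟩
    have h2 : 0 < {y ∈ V | ∀ k ∈ MulAction.stabilizer K x, k • y = y}.ncard := by
      rw [← h, Set.ncard_pos (Set.toFinite _)]
      exact ⟨x, hx, fun k hk => hk⟩
    rw [Set.ncard_pos (Set.toFinite _)] at h2
    obtain ⟨y, hy, hyH⟩ := h2
    have hst : MulAction.stabilizer K x = MulAction.stabilizer K y := by
      have h3 : 0 < {x ∈ U | ∀ k ∈ MulAction.stabilizer K y, k • x = x}.ncard := by
        rw [h, Set.ncard_pos (Set.toFinite _)]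
        exact ⟨y, hy, fun k hk => hk⟩
      rw [Set.ncard_pos (Set.toFinite _)] at h3
      obtain ⟨z, hz, hz'⟩ := h3
      have h4 : Nat.card (MulAction.stabilizer K y) ≤ Nat.card (MulAction.stabilizer K z) :=
        Subgroup.card_le_of_le (fun k hk => hz' k hk)
      exact Subgroup.eq_of_le_of_card_ge (fun k hk => hyH k hk) (h4.trans (hmax z hz))
    obtain ⟨g, hg, hgk⟩ := exists_bijOn_orbit hst
    have hOU : MulAction.orbit K x ⊆ U := by rintro _ ⟨k, rfl⟩; exact hU k x hx
    have hOV : MulAction.orbit K y ⊆ V := by rintro _ ⟨k, rfl⟩; exact hV k y hy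
    have hfix : ∀ H : Subgroup K, {z ∈ MulAction.orbit K x | ∀ k ∈ H, k • z = z}.ncard =
        {z ∈ MulAction.orbit K y | ∀ k ∈ H, k • z = z}.ncard := by
      intro H
      rw [← (hg.injOn.mono (Set.sep_subset _ _)).ncard_image]
      congr 1
      ext z
      constructor
      · rintro ⟨w, ⟨hw, hw'⟩, rfl⟩
        exact ⟨hg.mapsTo hw, fun k hk => by rw [← hgk k w hw, hw' k hk]⟩
      · rintro ⟨hz, hz'⟩
        obtain ⟨w, hw, rfl⟩ := hg.surjOn hz
        refine ⟨w, ⟨hw, fun k hk => ?_⟩, rfl⟩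
        refine hg.injOn (smul_mem_orbit_of_mem_orbit k hw) hw ?_
        rw [hgk k w hw, hz' k hk]
    have hlt : (U \ MulAction.orbit K x).ncard < n := by
      rw [← hn]
      exact Set.ncard_lt_ncard ⟨Set.sdiff_subset, fun hc => (hc hx).2 (MulAction.mem_orbit_self x)⟩
        (Set.toFinite _)
    obtain ⟨f, hf, hfk⟩ := ih _ hlt (U \ MulAction.orbit K x) (V \ MulAction.orbit K y)
      (smul_mem_diff_orbit hU) (smul_mem_diff_orbit hV) (fun H => by
        have h5 := ncard_fixed_diff_orbit hOU H
        have h6 := ncard_fixed_diff_orbit hOV H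
        have h7 := h H
        have h8 := hfix H
        omega) rfl
    refine ⟨fun z => if z ∈ MulAction.orbit K x then g z else f z, ⟨?_, ?_, ?_⟩, ?_⟩
    · intro z hz
      dsimp only
      split_ifs with hzo
      · exact hOV (hg.mapsTo hzo)
      · exact (hf.mapsTo ⟨hz, hzo⟩).1
    · intro z hz w hw he
      dsimp only at he
      split_ifs at he with h9 h10 h10
      · exact hg.injOn h9 h10 he
      · exact absurd (he ▸ hg.mapsTo h9) (hf.mapsTo ⟨hw, h10⟩).2
      · exact absurd (he ▸ hg.mapsTo h10) (hf.mapsTo ⟨hz, h9⟩).2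
      · exact hf.injOn ⟨hz, h9⟩ ⟨hw, h10⟩ he
    · intro w hw
      by_cases hwo : w ∈ MulAction.orbit K y
      · obtain ⟨z, hz, rfl⟩ := hg.surjOn hwo
        exact ⟨z, hOU hz, if_pos hz⟩
      · obtain ⟨z, hz, rfl⟩ := hf.surjOn ⟨hw, hwo⟩
        exact ⟨z, hz.1, if_neg hz.2⟩
    · intro k z hz
      dsimp only
      by_cases hzo : z ∈ MulAction.orbit K x
      · rw [if_pos hzo, if_pos (smul_mem_orbit_of_mem_orbit k hzo), hgk k z hzo]
      · rw [if_neg hzo, if_neg (smul_mem_diff_orbit hU k z ⟨hz, hzo⟩).2, hfk k z ⟨hz, hzo⟩]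

/-- Two actions of a finite group on finite sets are isomorphic if all subgroups have the same
number of fixed points. -/
theorem exists_equivariant_equiv {K X Y : Type*} [Group K] [Finite K] [Finite X]
    [Finite Y] (a : K →* Equiv.Perm X) (b : K →* Equiv.Perm Y)
    (h : ∀ H : Subgroup K, Nat.card {x : X // ∀ k ∈ H, a k x = x} =
      Nat.card {y : Y // ∀ k ∈ H, b k y = y}) :
    ∃ e : X ≃ Y, ∀ (k : K) (x : X), e (a k x) = b k (e x) := by
  let : MulAction K X := MulAction.compHom X a
  let : MulAction K Y := MulAction.compHom Y b
  rcases isEmpty_or_nonempty Y with hY | hY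
  · have hX : IsEmpty X := by
      refine ⟨fun x => ?_⟩
      have h1 := h ⊥
      have : IsEmpty {y : Y // ∀ k ∈ (⊥ : Subgroup K), b k y = y} := ⟨fun y => hY.elim y.1⟩
      rw [Nat.card_of_isEmpty (α := {y : Y // ∀ k ∈ (⊥ : Subgroup K), b k y = y})] at h1
      have : Nonempty {x : X // ∀ k ∈ (⊥ : Subgroup K), a k x = x} :=
        ⟨⟨x, fun k hk => by simp [Subgroup.mem_bot.1 hk]⟩⟩
      exact Nat.card_pos.ne' h1
    exact ⟨Equiv.equivOfIsEmpty X Y, fun k x => hX.elim x⟩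
  · obtain ⟨f, hf, hfk⟩ := exists_equivariant_bijOn (K := K) (Set.univ : Set X) (Set.univ : Set Y)
      (by simp) (by simp) (fun H => by
        simp only [Set.mem_univ, true_and]
        exact h H)
    exact ⟨Equiv.ofBijective f (Set.bijOn_univ.1 hf), fun k x => hfk k x trivial⟩

/-- Burnside's orbit counting, applied to the fixed points of a normal subgroup. -/
theorem card_dvd_sum_card_fixed {N G X : Type*} [Group N] [Fintype N] [Group G] [MulAction G X]
    [Finite X] (f : N →* G) (M : Subgroup N) [M.Normal] :
    Nat.card N ∣ ∑ g : N,
      Nat.card {x : X // ∀ k ∈ (M ⊔ Subgroup.zpowers g).map f, k • x = x} := by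
  classical
  let : MulAction N X := MulAction.compHom X f
  let Y : SubMulAction N X :=
    { carrier := {x | ∀ m ∈ M, m • x = x}
      smul_mem' := fun g x hx m hm => by
        have h1 : g⁻¹ * m * g ∈ M := by
          simpa using Subgroup.Normal.conj_mem ‹M.Normal› m hm g⁻¹
        have h2 := hx _ h1
        rw [mul_smul, mul_smul, inv_smul_eq_iff] at h2
        exact h2 }
  let : Fintype X := Fintype.ofFinite X
  let : Fintype (Quotient (MulAction.orbitRel N Y)) := Fintype.ofFinite _
  have h := MulAction.sum_card_fixedBy_eq_card_orbits_mul_card_group N Y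
  rw [Nat.card_eq_fintype_card]
  refine Dvd.intro_left _ (h.symm.trans (Finset.sum_congr rfl fun g _ => ?_))
  rw [← Nat.card_eq_fintype_card]
  refine Nat.card_congr ⟨fun z => ⟨z.1.1, ?_⟩, fun z => ⟨⟨z.1, ?_⟩, ?_⟩, fun _ => rfl, fun _ => rfl⟩
  · have h1 : M ⊔ Subgroup.zpowers g ≤ MulAction.stabilizer N z.1.1 := by
      refine sup_le (fun m hm => z.1.2 m hm) ?_
      rw [Subgroup.zpowers_le]
      exact congrArg Subtype.val z.2
    rintro _ ⟨k, hk, rfl⟩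
    exact h1 hk
  · exact fun m hm => z.2 _ ⟨m, (le_sup_left : M ≤ M ⊔ Subgroup.zpowers g) hm, rfl⟩
  · refine Subtype.ext (z.2 _ ⟨g, ?_, rfl⟩)
    exact (le_sup_right : _ ≤ M ⊔ Subgroup.zpowers g) (Subgroup.mem_zpowers g)

/-- The mark of `L` on `G ⧸ M`: the number of fixed points of `L` on the cosets of `M`. -/
noncomputable def mark {G : Type*} [Group G] (L M : Subgroup G) : ℕ :=
  Nat.card {x : G ⧸ M // ∀ l ∈ L, l • x = x}

theorem mark_mul_card {G : Type*} [Group G] (L M : Subgroup G) :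
    mark L M * Nat.card M = Nat.card {g : G // ∀ l ∈ L, g⁻¹ * l * g ∈ M} := by
  rw [mark, mul_comm, ← Nat.card_prod]
  refine (Nat.card_congr (QuotientGroup.preimageMkEquivSubgroupProdSet M
    {x : G ⧸ M | ∀ l ∈ L, l • x = x})).symm.trans (Nat.card_congr (Equiv.subtypeEquivRight ?_))
  intro g
  refine forall₂_congr fun l _ => ?_
  change ((l * g : G) : G ⧸ M) = (g : G ⧸ M) ↔ _
  rw [eq_comm, QuotientGroup.eq, mul_assoc]

theorem mark_ne_zero_iff {G : Type*} [Group G] [Finite G] {L M : Subgroup G} :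
    mark L M ≠ 0 ↔ ∃ g : G, ∀ l ∈ L, g⁻¹ * l * g ∈ M := by
  have h := mark_mul_card L M
  have hM : Nat.card M ≠ 0 := Nat.card_pos.ne'
  constructor
  · intro h0
    have : Nat.card {g : G // ∀ l ∈ L, g⁻¹ * l * g ∈ M} ≠ 0 := h ▸ mul_ne_zero h0 hM
    obtain ⟨⟨g, hg⟩⟩ := (Nat.card_ne_zero.1 this).1
    exact ⟨g, hg⟩
  · rintro ⟨g, hg⟩ h0
    rw [h0, zero_mul] at h
    have : Nonempty {g : G // ∀ l ∈ L, g⁻¹ * l * g ∈ M} := ⟨⟨g, hg⟩⟩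
    exact Nat.card_pos.ne' h.symm

/-- Conjugate subgroups have the same marks. -/
theorem mark_conj {G : Type*} [Group G] [Finite G] {L L' : Subgroup G} (h : G)
    (hL : ∀ l, l ∈ L ↔ h * l * h⁻¹ ∈ L') (M : Subgroup G) : mark L M = mark L' M := by
  refine Nat.eq_of_mul_eq_mul_right (Nat.card_pos : 0 < Nat.card M) ?_
  rw [mark_mul_card, mark_mul_card]
  refine Nat.card_congr ((Equiv.mulLeft h).subtypeEquiv fun g => ?_)
  constructor
  · intro hg l hl
    have := hg (h⁻¹ * l * h) ((hL _).2 (by simpa [mul_assoc] using hl))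
    simpa [mul_assoc] using this
  · intro hg l hl
    have := hg _ ((hL l).1 hl)
    simpa [mul_assoc] using this

theorem card_eq_of_conj {G : Type*} [Group G] {L M : Subgroup G} (h : G)
    (hM : ∀ l, l ∈ M ↔ h * l * h⁻¹ ∈ L) : Nat.card M = Nat.card L :=
  Nat.card_congr ((MulAut.conj h).toEquiv.subtypeEquiv fun l => hM l)

theorem card_normalizer_eq_of_conj {G : Type*} [Group G] {L M : Subgroup G} (h : G)
    (hM : ∀ l, l ∈ M ↔ h * l * h⁻¹ ∈ L) :
    Nat.card (Subgroup.normalizer (M : Set G)) = Nat.card (Subgroup.normalizer (L : Set G)) := by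
  refine card_eq_of_conj h fun g => ?_
  simp only [Subgroup.mem_normalizer_iff, hM]
  constructor
  · intro hg l
    have := hg (h⁻¹ * l * h)
    simpa [mul_assoc] using this
  · intro hg l
    have := hg (h * l * h⁻¹)
    simpa [mul_assoc] using this

theorem mark_mul_card_of_conj {G : Type*} [Group G] [Finite G] {L M : Subgroup G} (h : G)
    (hM : ∀ l, l ∈ M ↔ h * l * h⁻¹ ∈ L) :
    mark L M * Nat.card L = Nat.card (Subgroup.normalizer (L : Set G)) := by
  rw [← mark_conj h hM M, ← card_eq_of_conj h hM, mark_mul_card,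
    ← card_normalizer_eq_of_conj h hM]
  refine Nat.card_congr (Equiv.subtypeEquivRight fun g => ⟨fun hg => ?_, fun hg l hl => ?_⟩)
  · refine inv_mem_iff.1 (Subgroup.mem_normalizer_fintype fun l hl => ?_)
    simpa using hg l hl
  · simpa using (Subgroup.mem_normalizer_iff.1 (inv_mem hg) l).1 hl

end GSets

/-! ### Stable multiplicity functions -/

/-- The number of fixed points of `L` on a `G`-set with `c M` orbits isomorphic to `G ⧸ M`. -/
noncomputable def markSum {G : Type*} [Group G] [Fintype (Subgroup G)] (c : Subgroup G → ℕ)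
    (L : Subgroup G) : ℕ :=
  ∑ M : Subgroup G, c M * mark L M

theorem markSum_conj {G : Type*} [Group G] [Finite G] [Fintype (Subgroup G)]
    (c : Subgroup G → ℕ) {L L' : Subgroup G} (h : G)
    (hL : ∀ l, l ∈ L ↔ h * l * h⁻¹ ∈ L') : markSum c L = markSum c L' :=
  Finset.sum_congr rfl fun M _ => by rw [mark_conj h hL M]

theorem card_dvd_sum_markSum {N G : Type*} [Group N] [Fintype N] [Group G] [Finite G]
    [Fintype (Subgroup G)] (c : Subgroup G → ℕ) (f : N →* G) (M : Subgroup N) [M.Normal] :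
    Nat.card N ∣ ∑ g : N, markSum c ((M ⊔ Subgroup.zpowers g).map f) := by
  simp only [markSum]
  rw [Finset.sum_comm]
  refine Finset.dvd_sum fun K _ => ?_
  rw [← Finset.mul_sum]
  exact Dvd.dvd.mul_left (card_dvd_sum_card_fixed f M) _

namespace FusionSystem

variable {S : Type u} [Group S] (F : FusionSystem S)

/-- The graphs of the morphisms of `F` which are defined on `A` and are the identity there. -/
def graphsOver (A : Subgroup S) : Set (Subgroup (S × S)) :=
  {L | L ∈ F.graphs ∧ diagSubgroup A ≤ L}

/-- The fixed points of the graphs of order at least `n` of morphisms over `A` depend only on the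
domain of the morphism. -/
def StableAbove [Fintype (Subgroup (S × S))] (A : Subgroup S) (c : Subgroup (S × S) → ℕ)
    (n : ℕ) : Prop :=
  ∀ L ∈ F.graphsOver A, ∀ L' ∈ F.graphsOver A, relDom L = relDom L' → n ≤ Nat.card L →
    markSum c L = markSum c L'

variable {F}

theorem mem_graphs_of_mark_ne_zero [Finite S] {L M : Subgroup (S × S)} (hM : M ∈ F.graphs)
    (h : mark L M ≠ 0) : L ∈ F.graphs := by
  obtain ⟨⟨s, t⟩, hg⟩ := mark_ne_zero_iff.1 h
  exact graphs_of_conj hM s⁻¹ t⁻¹ fun x y hxy => by simpa using hg (x, y) hxy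

theorem markSum_eq_zero [Finite S] [Fintype (Subgroup (S × S))] {A : Subgroup S}
    {c : Subgroup (S × S) → ℕ} (hc : ∀ M, c M ≠ 0 → M ∈ F.graphsOver A) {L : Subgroup (S × S)}
    (hL : L ∉ F.graphs) : markSum c L = 0 := by
  refine Finset.sum_eq_zero fun M _ => ?_
  by_contra h
  obtain ⟨h1, h2⟩ := mul_ne_zero_iff.1 h
  exact hL (mem_graphs_of_mark_ne_zero (hc M h1).1 h2)

/-- Postcomposition with a morphism of `F` over `A` does not change the number of fixed points.
This covers arbitrary subgroups of `S × S`, as those which are not graphs have no fixed points. -/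
theorem StableAbove.markSum_relComp [Finite S] [Fintype (Subgroup (S × S))] {A : Subgroup S}
    {c : Subgroup (S × S) → ℕ} (hc : ∀ M, c M ≠ 0 → M ∈ F.graphsOver A) {n : ℕ}
    (hst : F.StableAbove A c n) {D K : Subgroup (S × S)} (hD : D ∈ F.graphsOver A)
    (hK : diagSubgroup A ≤ K) (hle : relIm K ≤ relDom D) (hn : n ≤ Nat.card K) :
    markSum c K = markSum c (relComp D K) := by
  by_cases hKg : K ∈ F.graphs
  · refine hst K ⟨hKg, hK⟩ _ ⟨relComp_mem_graphs hD.1 hKg, ?_⟩ (relDom_relComp hle).symm hn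
    have h1 := hD.2
    rw [diagSubgroup_le] at hK h1 ⊢
    exact fun a ha => ⟨a, h1 a ha, hK a ha⟩
  · rw [markSum_eq_zero hc hKg, markSum_eq_zero hc]
    intro hcomp
    refine hKg (graphs_mono (relComp_mem_graphs (relInv_mem_graphs hD.1) hcomp) ?_)
    rintro ⟨x, y⟩ hxy
    obtain ⟨z, hz⟩ := mem_relDom.1 (hle (mem_relIm.2 ⟨y, hxy⟩))
    exact ⟨z, hz, x, hz, hxy⟩

theorem snd_mem_normalizer_relDom {L : Subgroup (S × S)} {s t : S}
    (h : (s, t) ∈ Subgroup.normalizer (L : Set (S × S))) :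
    t ∈ Subgroup.normalizer (relDom L : Set S) := by
  rw [mem_normalizer_iff_pairs] at h
  rw [Subgroup.mem_normalizer_iff]
  intro y
  rw [mem_relDom, mem_relDom]
  constructor
  · rintro ⟨x, hx⟩
    exact ⟨_, (h x y).1 hx⟩
  · rintro ⟨x, hx⟩
    refine ⟨s⁻¹ * x * s, (h _ y).2 ?_⟩
    simpa [mul_assoc] using hx

/-- The congruence behind the inductive step. The normalizer of `L` acts on the fixed points of
`L`, and, through a morphism of `F` extending `L₀ ∘ L⁻¹`, on those of `L₀`. Elements outside of
`L` have the same number of fixed points on both sets, so that Burnside's orbit counting compares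
the contributions of the elements of `L`. -/
theorem StableAbove.card_normalizer_dvd [Finite S] {p : ℕ} (hF : F.IsSaturated p)
    [Fintype (Subgroup (S × S))] {A : Subgroup S}
    {c : Subgroup (S × S) → ℕ} (hc : ∀ M, c M ≠ 0 → M ∈ F.graphsOver A) {n : ℕ}
    (hst : F.StableAbove A c (n + 1)) {L L₀ : Subgroup (S × S)} (hL : L ∈ F.graphsOver A)
    (hL₀ : L₀ ∈ F.graphsOver A) (hdom : relDom L = relDom L₀) (hn : Nat.card L = n)
    (hcent : F.FullyCentralized (relIm L₀))
    (hnorm : ∀ t ∈ Subgroup.normalizer (relDom L₀ : Set S),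
      ∃ s, (s, t) ∈ Subgroup.normalizer (L₀ : Set (S × S))) :
    (Nat.card (Subgroup.normalizer (L : Set (S × S))) : ℤ) ∣
      Nat.card L * ((markSum c L : ℤ) - markSum c L₀) := by
  classical
  set D := relComp L₀ (relInv L) with hD
  have hDg : D ∈ F.graphs := relComp_mem_graphs hL₀.1 (relInv_mem_graphs hL.1)
  have hDi : relIm D = relIm L₀ := relIm_relComp (by rw [relIm_relInv, hdom])
  obtain ⟨D', hD', hDD', hext⟩ := hF.exists_graph_extension hDg (hDi ▸ hcent)
  -- the extension of `L₀ ∘ L⁻¹` is defined on the first projection of the normalizer of `L`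
  have hdomN : ∀ s t, (s, t) ∈ Subgroup.normalizer (L : Set (S × S)) → s ∈ relDom D' := by
    intro s t hst'
    obtain ⟨s₀, hs₀⟩ := hnorm t (hdom ▸ snd_mem_normalizer_relDom hst')
    refine hext s₀ s (mem_normalizer_of_pairs ?_)
    rintro x₀ x ⟨y, h1, h2⟩
    exact ⟨t * y * t⁻¹, (mem_normalizer_iff_pairs.1 hs₀ _ _).1 h1,
      (mem_normalizer_iff_pairs.1 hst' _ _).1 h2⟩
  have hAD' : diagSubgroup A ≤ D' := by
    have h1 := hL.2
    have h2 := hL₀.2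
    rw [diagSubgroup_le] at h1 h2 ⊢
    exact fun a ha => hDD' ⟨a, h2 a ha, h1 a ha⟩
  have hcompL : relComp D' L = L₀ := by
    have key : ∀ x₀ x z, (x₀, z) ∈ L₀ → (x, z) ∈ L → (x₀, x) ∈ D' := fun x₀ x z h1 h2 =>
      hDD' ⟨z, h1, h2⟩
    ext ⟨x₀, z⟩
    constructor
    · rintro ⟨x, h1, h2⟩
      obtain ⟨x₁, h3⟩ := mem_relDom.1 (hdom ▸ mem_relDom.2 ⟨x, h2⟩ : z ∈ relDom L₀)
      obtain rfl : x₀ = x₁ := graphs_functional hD' h1 (key x₁ x z h3 h2)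
      exact h3
    · intro h1
      obtain ⟨x, h2⟩ := mem_relDom.1 (hdom ▸ mem_relDom.2 ⟨x₀, h1⟩ : z ∈ relDom L)
      exact ⟨x, key _ _ _ h1 h2, h2⟩
  have hD'' : D' ∈ F.graphsOver A := ⟨hD', hAD'⟩
  obtain ⟨R, θ, hθ, rfl⟩ := hD'
  rw [relDom_relGraph] at hdomN
  set N := Subgroup.normalizer (L : Set (S × S)) with hN
  let fstN : N →* R := ((MonoidHom.fst S S).comp N.subtype).codRestrict R
    fun g => hdomN _ _ g.2
  let f₂ : N →* S × S := (θ.comp fstN).prod ((MonoidHom.snd S S).comp N.subtype)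
  set M := L.subgroupOf N with hM
  have hLN : L ≤ N := Subgroup.le_normalizer
  have : M.Normal := Subgroup.normal_in_normalizer
  let : Fintype N := Fintype.ofFinite N
  have h1 := card_dvd_sum_markSum c N.subtype M
  have h2 := card_dvd_sum_markSum c f₂ M
  have hcomp : ∀ K : Subgroup N, K.map f₂ = relComp (relGraph θ) (K.map N.subtype) := by
    intro K
    ext ⟨x, z⟩
    rw [mem_relComp]
    constructor
    · rintro ⟨k, hk, e⟩
      obtain ⟨rfl, rfl⟩ := Prod.mk.inj e
      exact ⟨k.1.1, mem_relGraph.2 ⟨hdomN _ _ k.2, rfl⟩, ⟨k, hk, rfl⟩⟩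
    · rintro ⟨y, h3, ⟨⟨⟨k1, k2⟩, hk⟩, hk', e⟩⟩
      obtain ⟨rfl, rfl⟩ := Prod.mk.inj e
      obtain ⟨hy, rfl⟩ := mem_relGraph.1 h3
      exact ⟨_, hk', rfl⟩
  have hMmap : M.map N.subtype = L := by
    rw [hM, Subgroup.subgroupOf_map_subtype, inf_eq_left.2 hLN]
  have hdiff : ∀ g : N, (markSum c ((M ⊔ Subgroup.zpowers g).map N.subtype) : ℤ) -
      markSum c ((M ⊔ Subgroup.zpowers g).map f₂) =
      if g ∈ M then (markSum c L : ℤ) - markSum c L₀ else 0 := by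
    intro g
    rw [hcomp]
    split_ifs with hg
    · rw [sup_eq_left.2 (by rwa [Subgroup.zpowers_le]), hMmap, hcompL]
    · -- `L` and `g` generate a larger subgroup, to which the stability assumption applies
      rw [sub_eq_zero, Nat.cast_inj]
      set K := (M ⊔ Subgroup.zpowers g).map N.subtype with hK
      have hLK : L ≤ K := hMmap ▸ Subgroup.map_mono le_sup_left
      have hgK : g.1 ∈ K := ⟨g, (le_sup_right : _ ≤ M ⊔ Subgroup.zpowers g)
        (Subgroup.mem_zpowers g), rfl⟩
      have hlt : L < K := lt_of_le_of_ne hLK fun h => hg (by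
        rw [hM, Subgroup.mem_subgroupOf, h]; exact hgK)
      have hcard : Nat.card L < Nat.card K := Set.ncard_lt_ncard hlt (Set.toFinite _)
      refine hst.markSum_relComp hc hD'' (hL.2.trans hLK) ?_ (by omega)
      rw [relDom_relGraph]
      intro x hx
      obtain ⟨y, k, -, hk⟩ := mem_relIm.1 hx
      have := hdomN x y
      exact this (hk ▸ k.2)
  have h3 : (Nat.card N : ℤ) ∣ ∑ g : N, ((markSum c ((M ⊔ Subgroup.zpowers g).map N.subtype) : ℤ) -
      markSum c ((M ⊔ Subgroup.zpowers g).map f₂)) := by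
    rw [Finset.sum_sub_distrib]
    exact dvd_sub (by exact_mod_cast h1) (by exact_mod_cast h2)
  rw [Finset.sum_congr rfl fun g _ => hdiff g, ← Finset.sum_filter, Finset.sum_const,
    nsmul_eq_mul] at h3
  have h4 : (Finset.univ.filter (· ∈ M)).card = Nat.card L := by
    rw [← Nat.card_congr (Subgroup.subgroupOfEquivOfLe hLN).toEquiv, Nat.card_eq_fintype_card,
      Fintype.card_subtype]
  rwa [h4] at h3

end FusionSystem

/-! ### The inductive step -/

/-- Conjugacy of subgroups. -/
def subgroupConjSetoid (G : Type*) [Group G] : Setoid (Subgroup G) where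
  r M M' := ∃ h : G, ∀ l, l ∈ M ↔ h * l * h⁻¹ ∈ M'
  iseqv :=
    { refl := fun M => ⟨1, by simp⟩
      symm := fun {M M'} => by
        rintro ⟨h, hM⟩
        exact ⟨h⁻¹, fun l => by rw [hM]; simp [mul_assoc]⟩
      trans := fun {M M' M''} => by
        rintro ⟨h, hM⟩ ⟨h', hM'⟩
        exact ⟨h' * h, fun l => by rw [hM, hM']; simp [mul_assoc]⟩ }

/-- A chosen representative of the conjugacy class of a subgroup. -/
noncomputable def conjRep {G : Type*} [Group G] (M : Subgroup G) : Subgroup G :=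
  (Quotient.mk (subgroupConjSetoid G) M).out

theorem conjRep_spec {G : Type*} [Group G] (M : Subgroup G) :
    ∃ h : G, ∀ l, l ∈ conjRep M ↔ h * l * h⁻¹ ∈ M :=
  Quotient.mk_out (s := subgroupConjSetoid G) M

theorem conjRep_eq_iff {G : Type*} [Group G] {M M' : Subgroup G} :
    conjRep M = conjRep M' ↔ ∃ h : G, ∀ l, l ∈ M ↔ h * l * h⁻¹ ∈ M' :=
  (Quotient.out_inj (s := subgroupConjSetoid G)).trans Quotient.eq

theorem conjRep_conjRep {G : Type*} [Group G] (M : Subgroup G) : conjRep (conjRep M) = conjRep M :=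
  conjRep_eq_iff.2 (conjRep_spec M)

theorem exists_conj_of_mark_ne_zero {G : Type*} [Group G] [Finite G] {L M : Subgroup G}
    (h : mark L M ≠ 0) (hcard : Nat.card M ≤ Nat.card L) :
    ∃ g : G, ∀ l, l ∈ L ↔ g * l * g⁻¹ ∈ M := by
  obtain ⟨g, hg⟩ := mark_ne_zero_iff.1 h
  have hle : L ≤ M.comap (MulAut.conj g⁻¹).toMonoidHom := fun l hl => by
    simpa using hg l hl
  have hcard' : Nat.card (M.comap (MulAut.conj g⁻¹).toMonoidHom) = Nat.card M :=
    card_eq_of_conj g⁻¹ fun l => Iff.rfl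
  refine ⟨g⁻¹, fun l => ?_⟩
  rw [Subgroup.eq_of_le_of_card_ge hle (by rw [hcard']; exact hcard)]
  rfl

theorem card_le_of_mark_ne_zero {G : Type*} [Group G] [Finite G] {L M : Subgroup G}
    (h : mark L M ≠ 0) : Nat.card L ≤ Nat.card M := by
  obtain ⟨g, hg⟩ := mark_ne_zero_iff.1 h
  have hle : L ≤ M.comap (MulAut.conj g⁻¹).toMonoidHom := fun l hl => by
    simpa using hg l hl
  rw [← card_eq_of_conj (L := M) (M := M.comap (MulAut.conj g⁻¹).toMonoidHom) g⁻¹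
    fun l => Iff.rfl]
  exact Subgroup.card_le_of_le hle

theorem markSum_add {G : Type*} [Group G] [Fintype (Subgroup G)] (c d : Subgroup G → ℕ)
    (L : Subgroup G) : markSum (fun M => c M + d M) L = markSum c L + markSum d L := by
  simp [markSum, add_mul, Finset.sum_add_distrib]

namespace FusionSystem

variable {S : Type u} [Group S] {F : FusionSystem S}

theorem graphsOver_of_conj {A : Subgroup S} (hAZ : A ≤ Subgroup.center S)
    {L M : Subgroup (S × S)} (hL : L ∈ F.graphsOver A) (h : S × S)
    (hM : ∀ l, l ∈ M ↔ h * l * h⁻¹ ∈ L) : M ∈ F.graphsOver A := by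
  refine ⟨graphs_of_conj hL.1 h.1 h.2 fun x y hxy => (hM (x, y)).1 hxy,
    diagSubgroup_le.2 fun a ha => (hM _).2 ?_⟩
  have h1 : h * (a, a) * h⁻¹ = (a, a) := by
    ext
    · simp [(Subgroup.mem_center_iff.1 (hAZ ha) h.1)]
    · simp [(Subgroup.mem_center_iff.1 (hAZ ha) h.2)]
  rw [h1]
  exact diagSubgroup_le.1 hL.2 a ha

open scoped Classical in
/-- The multiplicity function with value `e M` on the chosen representatives `M` of the conjugacy
classes of subgroups of order `n` in `F.graphsOver A`. -/
noncomputable def repMultiplicity (F : FusionSystem S) (A : Subgroup S) (n : ℕ)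
    (e : Subgroup (S × S) → ℕ) (M : Subgroup (S × S)) : ℕ :=
  if M ∈ F.graphsOver A ∧ Nat.card M = n ∧ conjRep M = M then e M else 0

theorem repMultiplicity_ne_zero {A : Subgroup S} {n : ℕ} {e : Subgroup (S × S) → ℕ}
    {M : Subgroup (S × S)} (h : F.repMultiplicity A n e M ≠ 0) :
    M ∈ F.graphsOver A ∧ Nat.card M = n ∧ conjRep M = M := by
  by_contra hc
  exact h (if_neg hc)

variable [Finite S] [Fintype (Subgroup (S × S))]

theorem markSum_repMultiplicity_of_lt {A : Subgroup S} {n : ℕ} {e : Subgroup (S × S) → ℕ}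
    {L : Subgroup (S × S)} (h : n < Nat.card L) : markSum (F.repMultiplicity A n e) L = 0 := by
  refine Finset.sum_eq_zero fun M _ => ?_
  by_contra hc
  obtain ⟨h1, h2⟩ := mul_ne_zero_iff.1 hc
  have h3 := (repMultiplicity_ne_zero h1).2.1
  have h4 := card_le_of_mark_ne_zero h2
  omega

theorem markSum_repMultiplicity_mul_card {A : Subgroup S} (hAZ : A ≤ Subgroup.center S) {n : ℕ}
    {e : Subgroup (S × S) → ℕ} {L : Subgroup (S × S)} (hL : L ∈ F.graphsOver A)
    (h : Nat.card L = n) :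
    markSum (F.repMultiplicity A n e) L * Nat.card L =
      e (conjRep L) * Nat.card (Subgroup.normalizer (L : Set (S × S))) := by
  obtain ⟨g, hg⟩ := conjRep_spec L
  rw [← mark_mul_card_of_conj g hg, ← mul_assoc]
  congr 1
  rw [markSum, Finset.sum_eq_single (conjRep L)]
  · rw [repMultiplicity, if_pos]
    exact ⟨graphsOver_of_conj hAZ hL g hg, (card_eq_of_conj g hg).trans h, conjRep_conjRep L⟩
  · intro M _ hne
    by_contra hc
    obtain ⟨h1, h2⟩ := mul_ne_zero_iff.1 hc
    obtain ⟨-, h3, h4⟩ := repMultiplicity_ne_zero h1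
    refine hne ?_
    rw [← h4]
    exact (conjRep_eq_iff.2 (exists_conj_of_mark_ne_zero h2 (h3.trans h.symm).le)).symm
  · exact fun hc => absurd (Finset.mem_univ _) hc

/-- The inductive step: orbits with stabilizers of order `n` can be added so that the fixed points
of the graphs of order `n` depend only on the domain. -/
theorem StableAbove.exists_extension {p : ℕ} [Fact p.Prime] (hS : IsPGroup p S)
    (hF : F.IsSaturated p) {A : Subgroup S} (hA : A ≤ F.center)
    {c : Subgroup (S × S) → ℕ} (hc : ∀ M, c M ≠ 0 → M ∈ F.graphsOver A) {n : ℕ}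
    (hst : F.StableAbove A c (n + 1)) :
    ∃ c' : Subgroup (S × S) → ℕ, (∀ M, c' M ≠ 0 → M ∈ F.graphsOver A) ∧ F.StableAbove A c' n ∧
      (∀ M, c M ≤ c' M) ∧ ∀ M : Subgroup (S × S), Nat.card M ≠ n → c' M = c M := by
  have hAZ : A ≤ Subgroup.center S := fun a ha => (hA ha).1
  -- the reference graph with a given domain
  have href : ∀ Q : Subgroup S, ∃ L₀ ∈ F.graphs, relDom L₀ = Q ∧
      F.FullyCentralized (relIm L₀) ∧ ∀ t ∈ Subgroup.normalizer (Q : Set S),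
        ∃ s, (s, t) ∈ Subgroup.normalizer (L₀ : Set (S × S)) := by
    intro Q
    obtain ⟨Q', hQ', hn'⟩ := F.exists_fullyNormalized Q
    obtain ⟨L₀, h1, h2, h3, h4⟩ := hF.exists_graph_of_fullyNormalized hS hQ' hn'
    exact ⟨L₀, h1, h2, h3 ▸ hF.fullyCentralized Q' hn', h4⟩
  choose L₀ hL₀ hL₀d hL₀c hL₀n using href
  -- the common number of fixed points to be reached for the graphs with domain `Q`; the second
  -- summand makes it large without changing its residues
  set T : Subgroup S → ℕ := fun Q => markSum c (L₀ (conjRep Q)) +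
    (∑ L : Subgroup (S × S), markSum c L) * Nat.card (S × S) with hT
  have hle : ∀ L Q, markSum c L ≤ T Q := by
    intro L Q
    have h1 : markSum c L ≤ ∑ L : Subgroup (S × S), markSum c L :=
      Finset.single_le_sum (fun _ _ => Nat.zero_le _) (Finset.mem_univ L)
    exact (h1.trans (Nat.le_mul_of_pos_right _ Nat.card_pos)).trans (Nat.le_add_left _ _)
  have hcong : ∀ L ∈ F.graphsOver A, Nat.card L = n →
      Nat.card (Subgroup.normalizer (L : Set (S × S))) ∣
        Nat.card L * (T (relDom L) - markSum c L) := by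
    intro L hL hn
    obtain ⟨t, ht⟩ := conjRep_spec (relDom L)
    -- a conjugate of `L` whose domain is the chosen representative
    set L₁ := L.comap (MulAut.conj ((1 : S), t)).toMonoidHom with hL₁
    have hconj : ∀ l, l ∈ L₁ ↔ ((1 : S), t) * l * ((1 : S), t)⁻¹ ∈ L := fun l => Iff.rfl
    have hL₁m := graphsOver_of_conj hAZ hL _ hconj
    have hdom : relDom L₁ = conjRep (relDom L) := by
      ext y
      rw [ht, mem_relDom, mem_relDom]
      exact ⟨fun ⟨x, hx⟩ => ⟨x, by simpa using (hconj _).1 hx⟩,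
        fun ⟨x, hx⟩ => ⟨x, (hconj _).2 (by simpa using hx)⟩⟩
    have hAQ : A ≤ conjRep (relDom L) := hdom ▸ fun a ha =>
      mem_relDom.2 ⟨a, diagSubgroup_le.1 hL₁m.2 a ha⟩
    have h1 := hst.card_normalizer_dvd hF hc hL₁m (L₀ := L₀ (conjRep (relDom L)))
      ⟨hL₀ _, hF.diagSubgroup_le_of_le_relDom hS hA (hL₀ _) ((hL₀d _).symm ▸ hAQ)⟩
      (by rw [hL₀d, hdom]) ((card_eq_of_conj _ hconj).trans hn) (hL₀c _)
      (by rw [hL₀d]; exact hL₀n _)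
    rw [card_normalizer_eq_of_conj _ hconj, card_eq_of_conj _ hconj,
      markSum_conj c _ hconj] at h1
    zify [hle L (relDom L)]
    have h2 : (Nat.card (Subgroup.normalizer (L : Set (S × S))) : ℤ) ∣ Nat.card (S × S) := by
      exact_mod_cast Subgroup.card_subgroup_dvd_card _
    have h3 : (Nat.card L : ℤ) * ((T (relDom L) : ℤ) - markSum c L) =
        Nat.card L * (∑ L : Subgroup (S × S), markSum c L : ℕ) * Nat.card (S × S) -
        Nat.card L * ((markSum c L : ℤ) - markSum c (L₀ (conjRep (relDom L)))) := by
      simp only [hT]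
      push_cast
      ring
    rw [h3]
    exact dvd_sub (h2.mul_left _) h1
  choose! e he using hcong
  refine ⟨fun M => c M + F.repMultiplicity A n e M, ?_, ?_, fun M => Nat.le_add_right _ _, ?_⟩
  · intro M hM
    by_cases h : c M = 0
    · exact (repMultiplicity_ne_zero (by simpa only [h, zero_add] using hM)).1
    · exact hc M h
  · -- the new number of fixed points of a graph of order `n` is the prescribed one
    have hval : ∀ L ∈ F.graphsOver A, Nat.card L = n →
        markSum (fun M => c M + F.repMultiplicity A n e M) L = T (relDom L) := by
      intro L hL hn
      obtain ⟨g, hg⟩ := conjRep_spec L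
      have h1 := markSum_repMultiplicity_mul_card hAZ (e := e) hL hn
      have hrep := graphsOver_of_conj hAZ hL g hg
      have h2 := he _ hrep ((card_eq_of_conj g hg).trans hn)
      have h3 : T (relDom (conjRep L)) = T (relDom L) := by
        have : conjRep (relDom (conjRep L)) = conjRep (relDom L) := by
          refine conjRep_eq_iff.2 ⟨g.2, fun y => ?_⟩
          rw [mem_relDom, mem_relDom]
          constructor
          · rintro ⟨x, hx⟩
            exact ⟨_, (hg _).1 hx⟩
          · rintro ⟨x, hx⟩
            refine ⟨g.1⁻¹ * x * g.1, (hg _).2 ?_⟩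
            simpa [Prod.mul_def, mul_assoc] using hx
        simp only [hT, this]
      rw [card_normalizer_eq_of_conj g hg, card_eq_of_conj g hg, markSum_conj c g hg, h3] at h2
      rw [mul_comm (e _), ← h2, mul_comm] at h1
      have h4 := Nat.eq_of_mul_eq_mul_left Nat.card_pos h1
      rw [markSum_add, h4]
      exact Nat.add_sub_cancel' (hle _ _)
    intro L hL L' hL' hd hn
    have hcard : Nat.card L = Nat.card L' := by
      rw [← card_relDom hL.1, ← card_relDom hL'.1, hd]
    rcases hn.eq_or_lt with h | h
    · rw [hval L hL h.symm, hval L' hL' (hcard.symm.trans h.symm), hd]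
    · rw [markSum_add, markSum_add, markSum_repMultiplicity_of_lt h,
        markSum_repMultiplicity_of_lt (hcard ▸ h), hst L hL L' hL' hd h]
  · intro M hM
    have : F.repMultiplicity A n e M = 0 := by
      by_contra h
      exact hM (repMultiplicity_ne_zero h).2.1
    simp [this]

end FusionSystem

/-! ### The start of the induction -/

namespace FusionSystem

variable {S : Type u} [Group S] {F : FusionSystem S}

theorem fullyNormalized_top [Finite S] : F.FullyNormalized ⊤ := by
  intro Q _
  have : Subgroup.normalizer ((⊤ : Subgroup S) : Set S) = ⊤ := top_le_iff.1 Subgroup.le_normalizer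
  rw [this, Subgroup.card_top]
  exact Subgroup.card_le_card_group _

theorem relIm_eq_top [Finite S] {L : Subgroup (S × S)} (hL : L ∈ F.graphs)
    (h : Nat.card L = Nat.card S) : relIm L = ⊤ :=
  Subgroup.eq_top_of_card_eq _ ((card_relIm hL).trans h)

theorem relDom_eq_top [Finite S] {L : Subgroup (S × S)} (hL : L ∈ F.graphs)
    (h : Nat.card L = Nat.card S) : relDom L = ⊤ :=
  Subgroup.eq_top_of_card_eq _ ((card_relDom hL).trans h)

/-- The normalizer of the graph of an automorphism is the product of the graph and
`Z(S) × 1`. -/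
theorem card_normalizer_of_card_eq [Finite S] {L : Subgroup (S × S)} (hL : L ∈ F.graphs)
    (h : Nat.card L = Nat.card S) :
    Nat.card (Subgroup.normalizer (L : Set (S × S))) =
      Nat.card L * Nat.card (Subgroup.center S) := by
  have hi := relIm_eq_top hL h
  have hd := relDom_eq_top hL h
  rw [← Nat.card_prod]
  symm
  have hz : ∀ z : Subgroup.center S,
      ((z : S), (1 : S)) ∈ Subgroup.normalizer (L : Set (S × S)) := fun z =>
    mem_normalizer_of_pairs fun x y hxy => by
      simpa [← Subgroup.mem_center_iff.1 z.2 x] using hxy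
  refine Nat.card_congr (Equiv.ofBijective
    (fun w : L × Subgroup.center S => (⟨w.1.1 * ((w.2 : S), 1),
      mul_mem (Subgroup.le_normalizer w.1.2) (hz w.2)⟩ :
        Subgroup.normalizer (L : Set (S × S)))) ⟨?_, ?_⟩)
  · rintro ⟨⟨⟨x, y⟩, hl⟩, z⟩ ⟨⟨⟨x', y'⟩, hl'⟩, z'⟩ e
    have e1 := congrArg Subtype.val e
    simp only [Prod.mk_mul_mk, mul_one, Prod.mk.injEq] at e1
    obtain ⟨e1, rfl⟩ := e1
    obtain rfl := graphs_functional hL hl hl'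
    have : z = z' := Subtype.ext (mul_left_cancel e1)
    rw [this]
  · rintro ⟨⟨s, t⟩, hst⟩
    obtain ⟨x, hx⟩ := mem_relDom.1 (hd ▸ Subgroup.mem_top t : t ∈ relDom L)
    have h1 : (x⁻¹ * s, (1 : S)) ∈ Subgroup.normalizer (L : Set (S × S)) := by
      have := mul_mem (inv_mem (Subgroup.le_normalizer hx)) hst
      simpa using this
    have hc : x⁻¹ * s ∈ Subgroup.center S := by
      rw [Subgroup.mem_center_iff]
      intro x'
      obtain ⟨y, hy⟩ := mem_relIm.1 (hi ▸ Subgroup.mem_top x' : x' ∈ relIm L)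
      have h2 := (mem_normalizer_iff_pairs.1 h1 x' y).1 hy
      simp only [one_mul, inv_one, mul_one] at h2
      have h3 := graphs_functional hL hy h2
      exact eq_mul_inv_iff_mul_eq.1 h3
    exact ⟨⟨⟨(x, t), hx⟩, ⟨_, hc⟩⟩, Subtype.ext (by simp)⟩

/-- The graph of an automorphism of `S` in `F`. -/
def autGraph (F : FusionSystem S) (α : F.autF ⊤) : Subgroup (S × S) :=
  relGraph ((⊤ : Subgroup S).subtype.comp (MulEquiv.toMonoidHom α.1))

theorem autGraph_mem_graphs (α : F.autF ⊤) : F.autGraph α ∈ F.graphs :=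
  relGraph_mem_graphs (subtype_comp_mem_HomS α.2.1)

theorem mem_autGraph {α : F.autF ⊤} {x y : S} :
    (x, y) ∈ F.autGraph α ↔ (α.1 ⟨y, trivial⟩ : S) = x :=
  mem_relGraph.trans ⟨fun ⟨_, h⟩ => h, fun h => ⟨trivial, h⟩⟩

theorem card_autGraph [Finite S] (α : F.autF ⊤) : Nat.card (F.autGraph α) = Nat.card S := by
  rw [← card_relDom (autGraph_mem_graphs α), autGraph, relDom_relGraph, Subgroup.card_top]

theorem exists_autGraph_eq [Finite S] {L : Subgroup (S × S)} (hL : L ∈ F.graphs)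
    (h : Nat.card L = Nat.card S) : ∃ α, F.autGraph α = L := by
  have hi := relIm_eq_top hL h
  have hd := relDom_eq_top hL h
  obtain ⟨P, φ, hφ, rfl⟩ := hL
  rw [relDom_relGraph] at hd
  subst hd
  rw [relIm_relGraph] at hi
  have hinj : Function.Injective φ := HomS.injective F hφ
  have hbij : Function.Bijective (φ.codRestrict ⊤ fun _ => Subgroup.mem_top _) := by
    refine ⟨fun a b hab => hinj (congrArg Subtype.val hab), fun y => ?_⟩
    obtain ⟨x, hx⟩ := MonoidHom.mem_range.1 (by rw [hi]; trivial : (y : S) ∈ φ.range)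
    exact ⟨x, Subtype.ext hx⟩
  set α : MulAut (⊤ : Subgroup S) := MulEquiv.ofBijective _ hbij with hα
  have hαφ : ∀ x, (α x : S) = φ x := fun x => rfl
  have hinv : (⊤ : Subgroup S).subtype.comp (MulEquiv.toMonoidHom α⁻¹) ∈ F.HomS ⊤ := by
    rw [← relGraph_mem_graphs_iff]
    refine graphs_mono (relInv_mem_graphs (relGraph_mem_graphs hφ)) ?_
    rintro ⟨x, y⟩ hxy
    obtain ⟨hy, rfl⟩ := mem_relGraph.1 hxy
    refine mem_relGraph.2 ⟨trivial, ?_⟩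
    change ((α (α⁻¹ ⟨y, hy⟩) : (⊤ : Subgroup S)) : S) = y
    simp
  exact ⟨⟨α, hφ, HomS.codRestrict_mem hinv fun _ => Subgroup.mem_top _⟩, rfl⟩

/-- The conjugacy classes of the graphs of automorphisms correspond to the outer automorphisms. -/
theorem conjRep_autGraph_eq_iff (α β : F.autF ⊤) :
    conjRep (F.autGraph α) = conjRep (F.autGraph β) ↔ α⁻¹ * β ∈ (autS ⊤).subgroupOf (F.autF ⊤) := by
  rw [conjRep_eq_iff, Subgroup.mem_subgroupOf]
  constructor
  · rintro ⟨⟨s, t⟩, h⟩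
    have h1 : ∀ y : (⊤ : Subgroup S),
        β.1 (⟨t, trivial⟩ * y * ⟨t, trivial⟩⁻¹) = ⟨s, trivial⟩ * α.1 y * ⟨s, trivial⟩⁻¹ := by
      intro y
      exact Subtype.ext (mem_autGraph.1 ((h (α.1 y, y)).1 (mem_autGraph.2 rfl)))
    set s' : (⊤ : Subgroup S) := ⟨s, trivial⟩
    set t' : (⊤ : Subgroup S) := ⟨t, trivial⟩
    refine ⟨⟨((α.1⁻¹ s') * t'⁻¹ : (⊤ : Subgroup S)), Subgroup.le_normalizer trivial⟩, ?_⟩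
    ext y
    have h2 := h1 (t'⁻¹ * y * t')
    have h3 : t' * (t'⁻¹ * y * t') * t'⁻¹ = y := by group
    rw [h3] at h2
    change _ = ((α.1⁻¹ (β.1 y) : (⊤ : Subgroup S)) : S)
    rw [h2]
    simp only [map_mul, map_inv, MulAut.inv_apply_self]
    change ((α.1⁻¹ s' * t'⁻¹ * y * (α.1⁻¹ s' * t'⁻¹)⁻¹ : (⊤ : Subgroup S)) : S) = _
    simp [mul_assoc]
  · rintro ⟨⟨u, hu⟩, h⟩
    have h1 : ∀ y : (⊤ : Subgroup S), β.1 y = α.1 (⟨u, trivial⟩ * y * ⟨u, trivial⟩⁻¹) := by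
      intro y
      have h2 := DFunLike.congr_fun h y
      have h3 : (Subgroup.normalizerMonoidHom ⊤ ⟨u, hu⟩) y = ⟨u, trivial⟩ * y * ⟨u, trivial⟩⁻¹ :=
        Subtype.ext rfl
      rw [← h3, h2]
      simp
    refine ⟨(1, u⁻¹), fun ⟨x, y⟩ => ?_⟩
    rw [Prod.mk_mul_mk, Prod.inv_mk, Prod.mk_mul_mk, mem_autGraph, mem_autGraph, h1]
    have h4 : (⟨u, trivial⟩ : (⊤ : Subgroup S)) * ⟨u⁻¹ * y * (u⁻¹)⁻¹, trivial⟩ * ⟨u, trivial⟩⁻¹ =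
        ⟨y, trivial⟩ := Subtype.ext (by simp [mul_assoc])
    change _ ↔ ((α.1 (⟨u, trivial⟩ * ⟨u⁻¹ * y * (u⁻¹)⁻¹, trivial⟩ * ⟨u, trivial⟩⁻¹) :
      (⊤ : Subgroup S)) : S) = 1 * x * 1⁻¹
    rw [h4]
    simp

theorem card_conjRep_top [Finite S] (A : Subgroup S)
    (hover : ∀ L ∈ F.graphs, Nat.card L = Nat.card S → L ∈ F.graphsOver A) :
    Nat.card {M : Subgroup (S × S) // M ∈ F.graphsOver A ∧ Nat.card M = Nat.card S ∧
      conjRep M = M} = ((autS ⊤).subgroupOf (F.autF ⊤)).index := by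
  symm
  have hrep : ∀ α, conjRep (F.autGraph α) ∈ F.graphsOver A ∧
      Nat.card (conjRep (F.autGraph α)) = Nat.card S ∧
      conjRep (conjRep (F.autGraph α)) = conjRep (F.autGraph α) := by
    intro α
    obtain ⟨g, hg⟩ := conjRep_spec (F.autGraph α)
    have hc := (card_eq_of_conj g hg).trans (card_autGraph α)
    exact ⟨hover _ (graphs_of_conj (autGraph_mem_graphs α) g.1 g.2
      fun x y hxy => (hg (x, y)).1 hxy) hc, hc, conjRep_conjRep _⟩
  refine Nat.card_congr (Equiv.ofBijective (Quotient.lift (fun α => ⟨_, hrep α⟩) ?_) ⟨?_, ?_⟩)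
  · intro α β h
    rw [← Quotient.eq_iff_equiv] at h
    exact Subtype.ext ((conjRep_autGraph_eq_iff α β).2 (QuotientGroup.eq.1 (Quotient.sound (by
      exact Quotient.exact h))))
  · rintro ⟨α⟩ ⟨β⟩ h
    exact QuotientGroup.eq.2 ((conjRep_autGraph_eq_iff α β).1 (congrArg Subtype.val h))
  · rintro ⟨M, hM, hc, hr⟩
    obtain ⟨α, rfl⟩ := exists_autGraph_eq hM.1 hc
    exact ⟨Quotient.mk _ α, Subtype.ext hr⟩

variable [Finite S] [Fintype (Subgroup (S × S))]

/-- The start of the induction: a number of copies of `S ×_(S, α) S` for `α` in a set of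
representatives of `Out_F(S)`, a group of order prime to `p`. -/
theorem exists_stableAbove_card {p : ℕ} [Fact p.Prime] (hS : IsPGroup p S)
    (hF : F.IsSaturated p) {A : Subgroup S} (hA : A ≤ F.center) :
    ∃ c : Subgroup (S × S) → ℕ, (∀ M, c M ≠ 0 → M ∈ F.graphsOver A) ∧
      F.StableAbove A c (Nat.card S) ∧
      (∑ M : Subgroup (S × S), if Nat.card M = Nat.card S then c M else 0) ≡ 1 [MOD p] ∧
      markSum c (diagSubgroup ⊤) ≠ 0 := by
  classical
  have hAZ : A ≤ Subgroup.center S := fun a ha => (hA ha).1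
  have hover : ∀ L ∈ F.graphs, Nat.card L = Nat.card S → L ∈ F.graphsOver A := fun L hL hc =>
    ⟨hL, hF.diagSubgroup_le_of_le_relDom hS hA hL (by rw [relDom_eq_top hL hc]; exact le_top)⟩
  have hcard := card_conjRep_top A hover
  set k := ((autS ⊤).subgroupOf (F.autF ⊤)).index with hk
  have hp : p.Prime := Fact.out
  have : Finite (MulAut (⊤ : Subgroup S)) := Finite.of_injective
    (fun f : MulAut (⊤ : Subgroup S) => (f : (⊤ : Subgroup S) → (⊤ : Subgroup S)))
    DFunLike.coe_injective
  have hkp : k.Coprime p := by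
    obtain ⟨T, hT⟩ := hF.sylow ⊤ fullyNormalized_top
    rw [Nat.coprime_comm, Nat.Prime.coprime_iff_not_dvd hp, hk, ← hT]
    exact T.not_dvd_index
  obtain ⟨m, -, hm⟩ := Nat.exists_mul_mod_eq_one_of_coprime hkp hp.one_lt
  have hm0 : m ≠ 0 := by
    rintro rfl
    simp at hm
  have hval : ∀ L ∈ F.graphs, Nat.card L = Nat.card S →
      markSum (F.repMultiplicity A (Nat.card S) fun _ => m) L =
        m * Nat.card (Subgroup.center S) := by
    intro L hL hc
    have h1 := markSum_repMultiplicity_mul_card hAZ (e := fun _ => m) (hover L hL hc) hc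
    rw [card_normalizer_of_card_eq hL hc, mul_left_comm, mul_comm] at h1
    exact Nat.eq_of_mul_eq_mul_left Nat.card_pos h1
  refine ⟨F.repMultiplicity A (Nat.card S) fun _ => m,
    fun M hM => (repMultiplicity_ne_zero hM).1, ?_, ?_, ?_⟩
  · intro L hL L' hL' hd hn
    have h1 : Nat.card L = Nat.card S := le_antisymm
      ((card_relDom hL.1).symm.trans_le (Subgroup.card_le_card_group _)) hn
    have h2 : Nat.card L' = Nat.card S := by
      rw [← h1, ← card_relDom hL.1, ← card_relDom hL'.1, hd]
    rw [hval L hL.1 h1, hval L' hL'.1 h2]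
  · have h1 : (∑ M : Subgroup (S × S), if Nat.card M = Nat.card S then
        F.repMultiplicity A (Nat.card S) (fun _ => m) M else 0) = k * m := by
      rw [← hcard, Nat.subtype_card (Finset.univ.filter fun M => M ∈ F.graphsOver A ∧
        Nat.card M = Nat.card S ∧ conjRep M = M) (by simp), ← smul_eq_mul,
        ← Finset.sum_const, Finset.sum_filter]
      refine Finset.sum_congr rfl fun M _ => ?_
      simp only [repMultiplicity]
      split_ifs <;> tauto
    rw [h1, Nat.ModEq, hm, Nat.mod_eq_of_lt hp.one_lt]
  · have hd : Nat.card (diagSubgroup (⊤ : Subgroup S)) = Nat.card S := by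
      rw [← card_relDom (diagSubgroup_mem_graphs (F := F) ⊤), diagSubgroup, relDom_relGraph,
        Subgroup.card_top]
    rw [hval _ (diagSubgroup_mem_graphs ⊤) hd]
    exact mul_ne_zero hm0 Nat.card_pos.ne'

/-- The multiplicities of the orbits of a characteristic biset on which both actions of `A`
coincide. -/
theorem exists_multiplicity {p : ℕ} [Fact p.Prime] (hS : IsPGroup p S)
    (hF : F.IsSaturated p) {A : Subgroup S} (hA : A ≤ F.center) :
    ∃ c : Subgroup (S × S) → ℕ, (∀ M, c M ≠ 0 → M ∈ F.graphsOver A) ∧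
      F.StableAbove A c 0 ∧
      (∑ M : Subgroup (S × S), c M * (Nat.card S / Nat.card M)) ≡ 1 [MOD p] ∧
      markSum c (diagSubgroup ⊤) ≠ 0 := by
  have key : ∀ k ≤ Nat.card S, ∃ c : Subgroup (S × S) → ℕ, (∀ M, c M ≠ 0 → M ∈ F.graphsOver A) ∧
      F.StableAbove A c (Nat.card S - k) ∧
      (∑ M : Subgroup (S × S), if Nat.card M = Nat.card S then c M else 0) ≡ 1 [MOD p] ∧
      markSum c (diagSubgroup ⊤) ≠ 0 := by
    intro k
    induction k with
    | zero => exact fun _ => exists_stableAbove_card hS hF hA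
    | succ k ih =>
      intro hk
      obtain ⟨c, h1, h2, h3, h4⟩ := ih (by omega)
      have h5 : Nat.card S - k = Nat.card S - (k + 1) + 1 := by omega
      rw [h5] at h2
      obtain ⟨c', h6, h7, h8, h9⟩ := h2.exists_extension hS hF hA h1
      refine ⟨c', h6, h7, ?_, fun h => h4 ?_⟩
      · convert h3 using 1
        refine Finset.sum_congr rfl fun M _ => ?_
        split_ifs with h
        · exact h9 M (by omega)
        · rfl
      · refine Nat.eq_zero_of_le_zero (le_trans ?_ h.le)
        exact Finset.sum_le_sum fun M _ => Nat.mul_le_mul_right _ (h8 M)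
  obtain ⟨c, h1, h2, h3, h4⟩ := key _ le_rfl
  rw [Nat.sub_self] at h2
  refine ⟨c, h1, h2, ?_, h4⟩
  refine Nat.ModEq.trans ?_ h3
  rw [← ZMod.natCast_eq_natCast_iff]
  push_cast
  refine Finset.sum_congr rfl fun M _ => ?_
  by_cases hM : c M = 0
  · simp [hM]
  have hMg := (h1 M hM).1
  split_ifs with h
  · rw [h, Nat.div_self Nat.card_pos]
    simp
  · have hdvd : Nat.card M ∣ Nat.card S := by
      rw [← card_relDom hMg]
      exact Subgroup.card_subgroup_dvd_card _
    have h5 : p ∣ Nat.card S / Nat.card M := by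
      obtain ⟨n, hn⟩ := IsPGroup.iff_card.1 hS
      have h6 : Nat.card S / Nat.card M ∣ p ^ n := hn ▸ Nat.div_dvd_of_dvd hdvd
      obtain ⟨j, -, hj⟩ := (Nat.dvd_prime_pow Fact.out).1 h6
      rw [hj]
      refine dvd_pow_self p ?_
      rintro rfl
      rw [pow_zero] at hj
      exact h (Nat.eq_of_dvd_of_div_eq_one hdvd hj)
    rw [(ZMod.natCast_eq_zero_iff _ _).2 h5]
    simp

end FusionSystem

/-! ### Bisets as sets with an action of `S × S` -/

section Bisets

open MulOpposite

variable {S : Type u} [Group S]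

/-- The action of `S × S` on a biset, `(s, t) x = s x t⁻¹`. -/
def bisetPermHom (S : Type u) [Group S] (Λ : Type*) [MulAction S Λ] [MulAction Sᵐᵒᵖ Λ]
    [SMulCommClass S Sᵐᵒᵖ Λ] : S × S →* Equiv.Perm Λ where
  toFun g := MulAction.toPerm g.1 * MulAction.toPerm (op g.2⁻¹)
  map_one' := by ext; simp
  map_mul' g h := by
    ext x
    simp [mul_smul, smul_comm h.1 (op g.2)⁻¹]

theorem bisetPermHom_apply {Λ : Type*} [MulAction S Λ] [MulAction Sᵐᵒᵖ Λ]
    [SMulCommClass S Sᵐᵒᵖ Λ] (s t : S) (x : Λ) :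
    bisetPermHom S Λ (s, t) x = s • op t⁻¹ • x := rfl

instance (P : Subgroup S) (φ : P →* S) : SMulCommClass S Sᵐᵒᵖ (TransBiset P φ) where
  smul_comm := by
    rintro s t ⟨x⟩
    rfl

instance [Finite S] (P : Subgroup S) (φ : P →* S) : Finite (TransBiset P φ) :=
  inferInstanceAs (Finite (Quotient (transBisetSetoid P φ)))

theorem TransBiset.op_smul_eq_self {P : Subgroup S} {φ : P →* S} (hφ : Function.Injective φ)
    (t : S) (x : TransBiset P φ) (h : op t • x = x) : t = 1 := by
  obtain ⟨⟨x, y⟩⟩ := x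
  obtain ⟨g, h1, h2⟩ := Quotient.exact h
  have h3 : g = 1 := hφ (by simpa using h1)
  subst h3
  simpa using h2

theorem TransBiset.smul_eq_op_smul {P : Subgroup S} {φ : P →* S} {a : S}
    (ha : a ∈ Subgroup.center S) (h : (a, a) ∈ relGraph φ) (x : TransBiset P φ) :
    a • x = op a • x := by
  obtain ⟨⟨x, y⟩⟩ := x
  obtain ⟨haP, hφ⟩ := mem_relGraph.1 h
  refine Quotient.sound ⟨⟨a, haP⟩, ?_, ?_⟩
  · change a * x = x * φ ⟨a, haP⟩
    rw [hφ, Subgroup.mem_center_iff.1 ha x]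
  · exact Subgroup.mem_center_iff.1 ha y

/-- The biset `S ×_(P, φ) S` is the set of cosets of the graph of `φ` in `S × S`. -/
def quotientRelGraphEquiv {P : Subgroup S} (φ : P →* S) :
    ((S × S) ⧸ relGraph φ) ≃ TransBiset P φ :=
  Quotient.congr ((Equiv.refl S).prodCongr (Equiv.inv S)) (by
    rintro ⟨x, y⟩ ⟨x', y'⟩
    refine QuotientGroup.leftRel_apply.trans ?_
    change (x⁻¹ * x', y⁻¹ * y') ∈ relGraph φ ↔ ∃ g : P, x = x' * φ g ∧ y'⁻¹ = (g : S) * y⁻¹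
    rw [mem_relGraph]
    constructor
    · rintro ⟨hy, h⟩
      refine ⟨⟨y⁻¹ * y', hy⟩⁻¹, ?_, ?_⟩
      · rw [map_inv, h]; simp
      · simp
    · rintro ⟨g, rfl, h⟩
      have h1 : y⁻¹ * y' = ((g⁻¹ : P) : S) := by
        rw [eq_comm, Subgroup.coe_inv, inv_eq_iff_eq_inv, mul_inv_rev, inv_inv, h]
        simp
      refine ⟨h1 ▸ (g⁻¹).2, ?_⟩
      have h2 : (⟨y⁻¹ * y', h1 ▸ (g⁻¹).2⟩ : P) = g⁻¹ := Subtype.ext h1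
      rw [h2]
      simp)

theorem card_fixed_transBiset (L : Subgroup (S × S)) {P : Subgroup S} (φ : P →* S) :
    Nat.card {x : TransBiset P φ // ∀ l ∈ L, bisetPermHom S _ l x = x} = mark L (relGraph φ) := by
  refine (Nat.card_congr ((quotientRelGraphEquiv φ).subtypeEquiv fun x => ?_)).symm
  refine forall₂_congr fun l _ => ?_
  have h : quotientRelGraphEquiv φ (l • x) = bisetPermHom S _ l (quotientRelGraphEquiv φ x) := by
    obtain ⟨⟨x, y⟩⟩ := x
    obtain ⟨s, t⟩ := l
    change Quotient.mk _ (s * x, (t * y)⁻¹) = Quotient.mk _ (s * x, y⁻¹ * t⁻¹)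
    rw [mul_inv_rev]
  rw [← h, (quotientRelGraphEquiv φ).apply_eq_iff_eq]

theorem card_subtype_sigma {ι : Type*} [Fintype ι] {X : ι → Type*} [∀ i, Finite (X i)]
    (q : ∀ i, X i → Prop) :
    Nat.card {x : Σ i, X i // q x.1 x.2} = ∑ i, Nat.card {x : X i // q i x} := by
  rw [← Nat.card_sigma]
  exact Nat.card_congr ⟨fun x => ⟨x.1.1, x.1.2, x.2⟩, fun x => ⟨⟨x.1, x.2.1⟩, x.2.2⟩,
    fun _ => rfl, fun _ => rfl⟩

/-- Elements which act trivially can be added to a subgroup without changing its fixed points. -/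
theorem forall_mem_sup_iff_of_trivial {K X : Type*} [Group K] (a : K →* Equiv.Perm X)
    {H D : Subgroup K} (hD : ∀ k ∈ D, ∀ x, a k x = x) (x : X) :
    (∀ k ∈ H ⊔ D, a k x = x) ↔ ∀ k ∈ H, a k x = x := by
  refine ⟨fun h k hk => h k ((le_sup_left : H ≤ H ⊔ D) hk), fun h k hk => ?_⟩
  have hle : H ⊔ D ≤ (MulAction.stabilizer (Equiv.Perm X) x).comap a :=
    sup_le (fun k hk => h k hk) (fun k hk => hD k hk x)
  exact hle hk

end Bisets

namespace FusionSystem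

open MulOpposite

variable {S : Type u} [Group S] {F : FusionSystem S}

/-- Stability of a biset whose numbers of fixed points are given by a stable function. As the
diagonal of `A` acts trivially, it can be added to a subgroup without changing its fixed points,
and the morphism `φ` can be replaced by its extension to `A`. -/
theorem exists_equiv_of_stableAbove [Finite S] [Fintype (Subgroup (S × S))] {p : ℕ} [Fact p.Prime]
    (hS : IsPGroup p S) (hF : F.IsSaturated p) {A : Subgroup S} (hA : A ≤ F.center)
    {c : Subgroup (S × S) → ℕ} (hc : ∀ M, c M ≠ 0 → M ∈ F.graphsOver A)
    (hst : F.StableAbove A c 0) {Λ : Type*} [Finite Λ] [MulAction S Λ] [MulAction Sᵐᵒᵖ Λ]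
    [SMulCommClass S Sᵐᵒᵖ Λ] (hAΛ : ∀ a ∈ A, ∀ x : Λ, a • x = op a • x)
    (hfix : ∀ L : Subgroup (S × S),
      Nat.card {x : Λ // ∀ l ∈ L, bisetPermHom S Λ l x = x} = markSum c L)
    (P : Subgroup S) (φ : P →* S) (hφ : φ ∈ F.HomS P) :
    ∃ e : Λ ≃ Λ, (∀ (g : P) (x : Λ), e ((g : S) • x) = φ g • e x) ∧
      (∀ (t : Sᵐᵒᵖ) (x : Λ), e (t • x) = t • e x) := by
  obtain ⟨_, ⟨P', φ', hφ', rfl⟩, hext, hdiag⟩ :=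
    hF.exists_graph_extension_center hS hA (relGraph_mem_graphs hφ)
  have hext' : ∀ g : P, ∃ h : (g : S) ∈ P', φ' ⟨g, h⟩ = φ g := fun g =>
    mem_relGraph.1 (hext (mem_relGraph.2 ⟨g.2, rfl⟩))
  have hdiag' := diagSubgroup_le.1 hdiag
  have hAtriv : ∀ a ∈ A, ∀ x : Λ, bisetPermHom S Λ (a, a) x = x := by
    intro a ha x
    rw [bisetPermHom_apply, op_inv, smul_comm, hAΛ a ha, inv_smul_smul]
  -- the two actions of `P' × S`, and the diagonal of `A` as a subgroup of `P' × S`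
  let i : P' × S →* S × S := P'.subtype.prodMap (MonoidHom.id S)
  let j : P' × S →* S × S := φ'.prodMap (MonoidHom.id S)
  let D : Subgroup (P' × S) := (diagSubgroup A).comap i
  have hDi : ∀ k ∈ D, ∀ x, ((bisetPermHom S Λ).comp i) k x = x := by
    rintro ⟨⟨g, hg⟩, t⟩ hk x
    obtain ⟨ha, rfl⟩ : t ∈ A ∧ t = g := mem_diagSubgroup.1 hk
    exact hAtriv t ha x
  have hDj : ∀ k ∈ D, ∀ x, ((bisetPermHom S Λ).comp j) k x = x := by
    rintro ⟨⟨g, hg⟩, t⟩ hk x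
    obtain ⟨ha, rfl⟩ : t ∈ A ∧ t = g := mem_diagSubgroup.1 hk
    obtain ⟨_, h⟩ := mem_relGraph.1 (hdiag' t ha)
    have h1 : j (⟨t, hg⟩, t) = (t, t) := Prod.ext h rfl
    rw [MonoidHom.comp_apply, h1]
    exact hAtriv t ha x
  have hcount : ∀ (f : P' × S →* S × S) (H : Subgroup (P' × S)),
      Nat.card {x : Λ // ∀ k ∈ H, ((bisetPermHom S Λ).comp f) k x = x} =
        markSum c (H.map f) := by
    intro f H
    rw [← hfix]
    refine Nat.card_congr (Equiv.subtypeEquivRight fun x => ?_)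
    constructor
    · rintro h _ ⟨k, hk, rfl⟩
      exact h k hk
    · exact fun h k hk => h _ ⟨k, hk, rfl⟩
  obtain ⟨e, he⟩ := exists_equivariant_equiv ((bisetPermHom S Λ).comp i)
    ((bisetPermHom S Λ).comp j) (fun H => by
      have h1 : ∀ (f : P' × S →* S × S),
          (∀ k ∈ D, ∀ x, ((bisetPermHom S Λ).comp f) k x = x) →
          Nat.card {x : Λ // ∀ k ∈ H, ((bisetPermHom S Λ).comp f) k x = x} =
            markSum c ((H ⊔ D).map f) := fun f hf => by
        rw [← hcount]
        exact Nat.card_congr (Equiv.subtypeEquivRight fun x =>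
          (forall_mem_sup_iff_of_trivial _ hf x).symm)
      rw [h1 i hDi, h1 j hDj]
      have h2 : (H ⊔ D).map j = relComp (relGraph φ') ((H ⊔ D).map i) := by
        ext ⟨x, z⟩
        rw [mem_relComp]
        constructor
        · rintro ⟨k, hk, e⟩
          obtain ⟨rfl, rfl⟩ := Prod.mk.inj e
          exact ⟨k.1, mem_relGraph.2 ⟨k.1.2, rfl⟩, ⟨k, hk, rfl⟩⟩
        · rintro ⟨y, h3, ⟨⟨k1, k2⟩, hk, e⟩⟩
          obtain ⟨rfl, rfl⟩ := Prod.mk.inj e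
          obtain ⟨hy, rfl⟩ := mem_relGraph.1 h3
          exact ⟨_, hk, rfl⟩
      rw [h2]
      refine hst.markSum_relComp hc ⟨relGraph_mem_graphs hφ', hdiag⟩ ?_ ?_ (Nat.zero_le _)
      · rw [diagSubgroup_le]
        intro a ha
        obtain ⟨haP, _⟩ := mem_relGraph.1 (hdiag' a ha)
        exact ⟨(⟨a, haP⟩, a), (le_sup_right : D ≤ H ⊔ D) (mem_diagSubgroup.2 ⟨ha, rfl⟩), rfl⟩
      · rw [relDom_relGraph]
        intro x hx
        obtain ⟨y, k, -, hk⟩ := mem_relIm.1 hx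
        obtain ⟨rfl, -⟩ := Prod.mk.inj hk
        exact k.1.2)
  refine ⟨e, fun g x => ?_, fun t x => ?_⟩
  · obtain ⟨hg, h⟩ := hext' g
    have := he (⟨g, hg⟩, 1) x
    rw [← h]
    simpa [i, j, bisetPermHom_apply] using this
  · have := he (1, t.unop⁻¹) x
    simpa [i, j, bisetPermHom_apply] using this

/-- Existence of a characteristic biset on which both actions of `A` coincide. It contains a copy
of the biset `S`, and its right action is free. -/
theorem exists_isCharacteristicBiset {S : Type u} [Group S] {F : FusionSystem S} [Finite S] {p : ℕ}
    [Fact p.Prime] (hS : IsPGroup p S)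
    (hF : F.IsSaturated p) {A : Subgroup S} (hA : A ≤ F.center) :
    ∃ (Λ : Type u) (_ : MulAction S Λ) (_ : MulAction Sᵐᵒᵖ Λ) (_ : SMulCommClass S Sᵐᵒᵖ Λ),
      F.IsCharacteristicBiset p Λ ∧ (∀ a ∈ A, ∀ x : Λ, a • x = op a • x) ∧
      (∀ (t : S) (x : Λ), op t • x = x → t = 1) ∧ ∃ x₀ : Λ, ∀ s : S, s • x₀ = op s • x₀ := by
  classical
  let : Fintype (Subgroup (S × S)) := Fintype.ofFinite _
  obtain ⟨c, hc, hst, hsum, hdiag⟩ := exists_multiplicity hS hF hA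
  have hrep : ∀ M : {M // M ∈ F.graphsOver A}, ∃ (P : Subgroup S), ∃ φ ∈ F.HomS P,
      M.1 = relGraph φ := fun M => M.2.1
  choose P φ hφ hM using hrep
  let ι : Type u := Σ M : {M // M ∈ F.graphsOver A}, ULift.{u} (Fin (c M.1))
  let Λ : Type u := Σ i : ι, TransBiset (P i.1) (φ i.1)
  have hfin : Finite Λ := inferInstanceAs (Finite (Σ i : ι, TransBiset (P i.1) (φ i.1)))
  have hfix : ∀ L : Subgroup (S × S),
      Nat.card {x : Λ // ∀ l ∈ L, bisetPermHom S Λ l x = x} = markSum c L := by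
    intro L
    have h1 : ∀ x : Λ, (∀ l ∈ L, bisetPermHom S Λ l x = x) ↔
        ∀ l ∈ L, bisetPermHom S _ l x.2 = x.2 := by
      rintro ⟨i, x⟩
      refine forall₂_congr fun l _ => ?_
      change (⟨i, bisetPermHom S _ l x⟩ : Λ) = ⟨i, x⟩ ↔ _
      simp
    rw [Nat.card_congr (Equiv.subtypeEquivRight h1),
      card_subtype_sigma (X := fun i : ι => TransBiset (P i.1) (φ i.1))
        fun i x => ∀ l ∈ L, bisetPermHom S _ l x = x]
    simp only [card_fixed_transBiset, ← hM]
    rw [Fintype.sum_sigma]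
    simp only [Finset.sum_const, Finset.card_univ, Fintype.card_ulift, Fintype.card_fin,
      smul_eq_mul]
    rw [markSum, ← Finset.sum_subtype (Finset.univ.filter fun M => M ∈ F.graphsOver A) (by simp)
      fun M => c M * mark L M]
    refine Finset.sum_filter_of_ne fun M _ h => ?_
    exact hc M (left_ne_zero_of_mul h)
  have hAΛ : ∀ a ∈ A, ∀ x : Λ, a • x = op a • x := by
    rintro a ha ⟨i, x⟩
    exact Sigma.ext rfl (heq_of_eq (TransBiset.smul_eq_op_smul (hA ha).1
      (hM i.1 ▸ diagSubgroup_le.1 i.1.2.2 a ha) x))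
  have hcard : Nat.card Λ =
      Nat.card S * ∑ M : Subgroup (S × S), c M * (Nat.card S / Nat.card M) := by
    have h1 := hfix ⊥
    rw [Nat.card_congr (Equiv.subtypeUnivEquiv fun x l hl => by
      rw [Subgroup.mem_bot.1 hl, map_one]; rfl)] at h1
    rw [h1, markSum, Finset.mul_sum]
    refine Finset.sum_congr rfl fun M _ => ?_
    by_cases h0 : c M = 0
    · simp [h0]
    have hMg := (hc M h0).1
    have hdvd : Nat.card M ∣ Nat.card S := by
      rw [← card_relDom hMg]
      exact Subgroup.card_subgroup_dvd_card _
    rw [mul_left_comm]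
    congr 1
    refine Nat.eq_of_mul_eq_mul_right (Nat.card_pos : 0 < Nat.card M) ?_
    rw [mark_mul_card, mul_assoc, Nat.div_mul_cancel hdvd, ← Nat.card_prod]
    exact Nat.card_congr (Equiv.subtypeUnivEquiv fun g l hl => by
      rw [Subgroup.mem_bot.1 hl]; simp [one_mem])
  refine ⟨Λ, inferInstance, inferInstance, inferInstance, ⟨hfin, ?_, ?_, ?_⟩, hAΛ, ?_, ?_⟩
  · exact ⟨ι, fun i => P i.1, fun i => φ i.1, fun i => hφ i.1, Equiv.refl _, fun _ _ => rfl,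
      fun _ _ => rfl⟩
  · exact exists_equiv_of_stableAbove hS hF hA hc hst hAΛ hfix
  · rw [hcard, Nat.mul_div_cancel_left _ Nat.card_pos]
    exact hsum
  · rintro t ⟨i, x⟩ h
    exact TransBiset.op_smul_eq_self (HomS.injective F (hφ i.1)) t x
      (eq_of_heq (Sigma.mk.inj h).2)
  · rw [← hfix, Nat.card_ne_zero] at hdiag
    obtain ⟨⟨x₀, hx₀⟩⟩ := hdiag.1
    refine ⟨x₀, fun s => ?_⟩
    have := hx₀ (s, s) (mem_diagSubgroup.2 ⟨trivial, rfl⟩)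
    rw [bisetPermHom_apply, op_inv, smul_comm, inv_smul_eq_iff] at this
    exact this

end FusionSystem

/-! ### Representations induced along a biset -/

section Representations

open MulOpposite

open scoped ComplexOrder in
/-- Weyl's unitary trick: a finite-dimensional complex representation of a finite group preserves an
inner product, hence is isomorphic to one given by unitary matrices. -/
theorem exists_unitaryRep_equiv {G : Type u} [Group G] [Finite G] {W : Type*} [AddCommGroup W]
    [Module ℂ W] [FiniteDimensional ℂ W] (π : Representation ℂ G W) :
    ∃ (n : ℕ) (ρ : G →* Matrix.unitaryGroup (Fin n) ℂ), Nonempty ((unitaryRep ρ).Equiv π) := by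
  let : Fintype G := Fintype.ofFinite G
  let B := (Module.finBasis ℂ W).equivFun
  let core : InnerProductSpace.Core ℂ W :=
    { inner := fun v w => ∑ g : G, star (B (π g v)) ⬝ᵥ B (π g w)
      conj_inner_symm := fun v w => by
        change star (∑ g : G, star (B (π g w)) ⬝ᵥ B (π g v)) = _
        rw [star_sum]
        refine Finset.sum_congr rfl fun g _ => ?_
        exact (Matrix.star_dotProduct _ _).symm
      re_inner_nonneg := fun v => (RCLike.nonneg_iff.1 (Finset.sum_nonneg fun g _ =>
        dotProduct_star_self_nonneg (B (π g v)))).1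
      add_left := fun u v w => by
        simp [add_dotProduct, Finset.sum_add_distrib]
      smul_left := fun u v r => by
        simp [Finset.mul_sum]
      definite := fun v h => by
        have h1 := (Finset.sum_eq_zero_iff_of_nonneg fun g _ =>
          dotProduct_star_self_nonneg (B (π g v))).1 h 1 (Finset.mem_univ _)
        rw [dotProduct_star_self_eq_zero, map_one] at h1
        exact B.map_eq_zero_iff.1 h1 }
  let : NormedAddCommGroup W := core.toNormedAddCommGroup
  let : InnerProductSpace ℂ W := InnerProductSpace.ofCore core.toCore
  have hπ : ∀ g v w, inner ℂ (π g v) (π g w) = inner ℂ v w := by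
    intro g v w
    change (∑ h : G, star (B (π h (π g v))) ⬝ᵥ B (π h (π g w))) =
      ∑ h : G, star (B (π h v)) ⬝ᵥ B (π h w)
    refine Fintype.sum_equiv (Equiv.mulRight g) _ _ fun h => ?_
    simp
  let b := stdOrthonormalBasis ℂ W
  let Φ := LinearMap.toMatrixOrthonormal b
  have hmem : ∀ g, Φ (π g) ∈ Matrix.unitaryGroup (Fin (Module.finrank ℂ W)) ℂ := by
    intro g
    rw [Matrix.mem_unitaryGroup_iff', ← map_star, ← map_mul, ← map_one Φ]
    congr 1
    refine LinearMap.ext fun v => ext_inner_left ℂ fun w => ?_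
    change inner ℂ w (LinearMap.adjoint (π g) (π g v)) = inner ℂ w v
    rw [LinearMap.adjoint_inner_right, hπ]
  let ρ : G →* Matrix.unitaryGroup (Fin (Module.finrank ℂ W)) ℂ :=
    { toFun := fun g => ⟨Φ (π g), hmem g⟩
      map_one' := Subtype.ext (by simp)
      map_mul' := fun g h => Subtype.ext (by simp) }
  refine ⟨_, ρ, ⟨(Representation.Equiv.mk b.toBasis.equivFun fun g => ?_).symm⟩⟩
  refine LinearMap.ext fun v => ?_
  exact (LinearMap.toMatrix_mulVec_repr b.toBasis b.toBasis (π g) v).symm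

/-- Replacing the second factor of a product of representations by an isomorphic one. -/
noncomputable def Representation.Equiv.prodCongrRight {k G V W W' : Type*} [CommSemiring k] [Monoid G]
    [AddCommMonoid V] [AddCommMonoid W] [AddCommMonoid W'] [Module k V] [Module k W] [Module k W']
    (π : Representation k G V) {σ : Representation k G W} {σ' : Representation k G W'}
    (e : σ.Equiv σ') : (π.prod σ).Equiv (π.prod σ') :=
  Representation.Equiv.mk ((LinearEquiv.refl k V).prodCongr e.toLinearEquiv) fun g =>
    LinearMap.ext fun v => Prod.ext rfl (LinearMap.congr_fun (e.isIntertwining' g) v.2)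

variable {S : Type u} [Group S] {Λ : Type*} {n : ℕ}

/-- The action of `S` on the functions from `Λ` to `ℂⁿ` by translation. -/
def translationRep (S : Type u) [Group S] (Λ : Type*) [MulAction S Λ]
    (n : ℕ) : Representation ℂ S (Λ → Fin n → ℂ) where
  toFun s := LinearMap.funLeft ℂ (Fin n → ℂ) fun x : Λ => s⁻¹ • x
  map_one' := by
    refine LinearMap.ext fun f => funext fun x => ?_
    change f ((1 : S)⁻¹ • x) = f x
    rw [inv_one, one_smul]
  map_mul' s t := by
    refine LinearMap.ext fun f => funext fun x => ?_
    change f ((s * t)⁻¹ • x) = f (t⁻¹ • s⁻¹ • x)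
    rw [mul_inv_rev, mul_smul]

variable [MulAction S Λ] [MulAction Sᵐᵒᵖ Λ] [SMulCommClass S Sᵐᵒᵖ Λ]

/-- The representation `Λ ×_S ℂⁿ` obtained from a representation `ρ` on `ℂⁿ` by means of a biset
`Λ`, realized as the functions `f` on `Λ` with `f (x t) = ρ(t)⁻¹ f(x)`. -/
def bisetRep (Λ : Type*) [MulAction S Λ] [MulAction Sᵐᵒᵖ Λ] [SMulCommClass S Sᵐᵒᵖ Λ]
    (ρ : S →* Matrix.unitaryGroup (Fin n) ℂ) : Subrepresentation (translationRep S Λ n) where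
  toSubmodule :=
    { carrier := {f | ∀ (x : Λ) (t : S), f (op t • x) = unitaryRep ρ t⁻¹ (f x)}
      zero_mem' := fun x t => (map_zero _).symm
      add_mem' := fun {f g} hf hg x t => by
        rw [Pi.add_apply, Pi.add_apply, map_add, hf, hg]
      smul_mem' := fun c f hf x t => by
        rw [Pi.smul_apply, Pi.smul_apply, map_smul, hf] }
  apply_mem_toSubmodule s f hf x t := by
    change f (s⁻¹ • op t • x) = unitaryRep ρ t⁻¹ (f (s⁻¹ • x))
    rw [smul_comm]
    exact hf _ t

/-- If two homomorphisms `f₁, f₂` give isomorphic actions on the biset, then the restrictions of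
`Λ ×_S ℂⁿ` along them are isomorphic. -/
theorem bisetRep_comp_equiv (ρ : S →* Matrix.unitaryGroup (Fin n) ℂ) {P : Type*}
    [Group P] (f₁ f₂ : P →* S) (e : Λ ≃ Λ) (he : ∀ (g : P) (x : Λ), e (f₁ g • x) = f₂ g • e x)
    (he' : ∀ (t : Sᵐᵒᵖ) (x : Λ), e (t • x) = t • e x) :
    Nonempty (Representation.Equiv ((bisetRep Λ ρ).toRepresentation.comp f₁)
      ((bisetRep Λ ρ).toRepresentation.comp f₂)) := by
  have he'' : ∀ (t : Sᵐᵒᵖ) (x : Λ), e.symm (t • x) = t • e.symm x := fun t x => by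
    rw [Equiv.symm_apply_eq, he', Equiv.apply_symm_apply]
  let E : (bisetRep Λ ρ).toSubmodule ≃ₗ[ℂ] (bisetRep Λ ρ).toSubmodule :=
    { toFun := fun F => ⟨fun x => F.1 (e.symm x), fun x t => by
        dsimp only
        rw [he'', F.2]⟩
      invFun := fun F => ⟨fun x => F.1 (e x), fun x t => by
        dsimp only
        rw [he', F.2]⟩
      map_add' := fun _ _ => rfl
      map_smul' := fun _ _ => rfl
      left_inv := fun F => Subtype.ext (funext fun x => congrArg F.1 (e.symm_apply_apply x))
      right_inv := fun F => Subtype.ext (funext fun x => congrArg F.1 (e.apply_symm_apply x)) }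
  refine ⟨Representation.Equiv.mk E fun g => LinearMap.ext fun F => Subtype.ext
    (funext fun x => ?_)⟩
  change F.1 ((f₁ g)⁻¹ • e.symm x) = F.1 (e.symm ((f₂ g)⁻¹ • x))
  have : e.symm ((f₂ g)⁻¹ • x) = (f₁ g)⁻¹ • e.symm x := by
    rw [Equiv.symm_apply_eq, ← map_inv, ← map_inv, he, Equiv.apply_symm_apply]
  rw [this]

/-- The functions in `Λ ×_S ℂⁿ` which vanish on the orbit of a point `x₀` with `s x₀ = x₀ s`. -/
def bisetRepOff (ρ : S →* Matrix.unitaryGroup (Fin n) ℂ) (x₀ : Λ)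
    (hx₀ : ∀ s : S, s • x₀ = op s • x₀) : Subrepresentation (translationRep S Λ n) where
  toSubmodule :=
    { carrier := {f | f ∈ (bisetRep Λ ρ).toSubmodule ∧ ∀ t : S, f (op t • x₀) = 0}
      zero_mem' := ⟨zero_mem _, fun _ => rfl⟩
      add_mem' := fun {f g} hf hg => ⟨add_mem hf.1 hg.1, fun t => by
        rw [Pi.add_apply, hf.2, hg.2, add_zero]⟩
      smul_mem' := fun c f hf => ⟨Submodule.smul_mem _ c hf.1, fun t => by
        rw [Pi.smul_apply, hf.2, smul_zero]⟩ }
  apply_mem_toSubmodule s f hf := by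
    refine ⟨(bisetRep Λ ρ).apply_mem_toSubmodule s hf.1, fun t => ?_⟩
    change f (s⁻¹ • op t • x₀) = 0
    rw [smul_comm, hx₀, ← mul_smul]
    exact hf.2 _

/-- `Λ ×_S ℂⁿ` is the direct sum of `ρ`, given by the values at `x₀`, and the functions which
vanish on the orbit of `x₀`. -/
theorem bisetRep_equiv_prod (ρ : S →* Matrix.unitaryGroup (Fin n) ℂ) (x₀ : Λ)
    (hx₀ : ∀ s : S, s • x₀ = op s • x₀) (hfree : ∀ t : S, op t • x₀ = x₀ → t = 1) :
    Nonempty (Representation.Equiv (bisetRep Λ ρ).toRepresentation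
      ((unitaryRep ρ).prod (bisetRepOff ρ x₀ hx₀).toRepresentation)) := by
  classical
  let O : Set Λ := {x | ∃ t : S, op t • x₀ = x}
  have hOr : ∀ (t : S) (x : Λ), op t • x ∈ O ↔ x ∈ O := by
    intro t x
    constructor
    · rintro ⟨t', h⟩
      refine ⟨t' * t⁻¹, ?_⟩
      rw [op_mul, mul_smul, h, op_inv, inv_smul_smul]
    · rintro ⟨t', rfl⟩
      exact ⟨t' * t, by rw [op_mul, mul_smul]⟩
  have hOl : ∀ (s : S) (x : Λ), x ∈ O → s • x ∈ O := by
    rintro s _ ⟨t, rfl⟩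
    refine ⟨s * t, ?_⟩
    rw [smul_comm, hx₀, ← mul_smul, op_mul]
  have hOl' : ∀ (s : S) (x : Λ), s • x ∈ O ↔ x ∈ O := fun s x =>
    ⟨fun h => by simpa using hOl s⁻¹ _ h, hOl s x⟩
  have hcancel : ∀ t t' : S, op t • x₀ = op t' • x₀ → t = t' := by
    intro t t' h
    have h1 : op (t * t'⁻¹) • x₀ = x₀ := by
      rw [op_mul, mul_smul, h, op_inv, inv_smul_smul]
    exact mul_inv_eq_one.1 (hfree _ h1)
  -- evaluation at `x₀` and restriction to the complement of the orbit
  let E : (bisetRep Λ ρ).toSubmodule →ₗ[ℂ] (Fin n → ℂ) × (bisetRepOff ρ x₀ hx₀).toSubmodule :=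
    { toFun := fun F => (F.1 x₀, ⟨fun x => if x ∈ O then 0 else F.1 x, by
        refine ⟨fun x t => ?_, fun t => if_pos ⟨t, rfl⟩⟩
        simp only [hOr]
        split_ifs
        · exact (map_zero _).symm
        · exact F.2 x t⟩)
      map_add' := fun F F' => by
        refine Prod.ext rfl (Subtype.ext (funext fun x => ?_))
        change (if x ∈ O then 0 else F.1 x + F'.1 x) =
          (if x ∈ O then 0 else F.1 x) + (if x ∈ O then 0 else F'.1 x)
        split_ifs <;> simp
      map_smul' := fun c F => by
        refine Prod.ext rfl (Subtype.ext (funext fun x => ?_))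
        change (if x ∈ O then 0 else c • F.1 x) = c • (if x ∈ O then 0 else F.1 x)
        split_ifs <;> simp }
  have hE : ∀ F x, (E F).2.1 x = if x ∈ O then 0 else F.1 x := fun F x => rfl
  have hinj : Function.Injective E := by
    rw [← LinearMap.ker_eq_bot, LinearMap.ker_eq_bot']
    intro F hF
    refine Subtype.ext (funext fun x => ?_)
    change F.1 x = 0
    by_cases hx : x ∈ O
    · obtain ⟨t, rfl⟩ := hx
      have h1 : F.1 x₀ = 0 := congrArg Prod.fst hF
      rw [F.2 x₀ t, h1, map_zero]
    · have h1 := hE F x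
      rw [hF, if_neg hx] at h1
      exact h1.symm
  have hsurj : Function.Surjective E := by
    rintro ⟨v, k⟩
    let f : Λ → Fin n → ℂ := fun x =>
      if h : x ∈ O then unitaryRep ρ (h.choose)⁻¹ v else k.1 x
    have hf : ∀ t, f (op t • x₀) = unitaryRep ρ t⁻¹ v := by
      intro t
      have h : op t • x₀ ∈ O := ⟨t, rfl⟩
      have h1 : h.choose = t := hcancel _ _ h.choose_spec
      simp only [f, dif_pos h, h1]
    have hf' : ∀ x, x ∉ O → f x = k.1 x := fun x hx => dif_neg hx
    refine ⟨⟨f, fun x t => ?_⟩, Prod.ext ?_ (Subtype.ext (funext fun x => ?_))⟩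
    · by_cases hx : x ∈ O
      · obtain ⟨t', rfl⟩ := hx
        rw [← mul_smul, ← op_mul, hf, hf, mul_inv_rev, map_mul]
        rfl
      · rw [hf' _ (fun h => hx ((hOr t x).1 h)), hf' x hx]
        exact k.2.1 x t
    · have := hf 1
      rw [op_one, one_smul, inv_one, map_one] at this
      exact this
    · rw [hE]
      split_ifs with hx
      · obtain ⟨t, rfl⟩ := hx
        exact (k.2.2 t).symm
      · exact hf' x hx
  refine ⟨Representation.Equiv.mk (LinearEquiv.ofBijective E ⟨hinj, hsurj⟩) fun s =>
    LinearMap.ext fun F => Prod.ext ?_ (Subtype.ext (funext fun x => ?_))⟩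
  · change F.1 (s⁻¹ • x₀) = unitaryRep ρ s (F.1 x₀)
    rw [hx₀, F.2 x₀ s⁻¹, inv_inv]
  · change (if x ∈ O then 0 else F.1 (s⁻¹ • x)) = if s⁻¹ • x ∈ O then 0 else F.1 (s⁻¹ • x)
    simp only [hOl']

/-- A representation induced along a biset on which both actions of `A` coincide is an
`A`-representation if the original one is. -/
theorem bisetRep_apply_of_isARep {A : Subgroup S} {χ : A →* Circle}
    {ρ : S →* Matrix.unitaryGroup (Fin n) ℂ} (hρ : IsARep χ ρ)
    (hA : ∀ a ∈ A, ∀ x : Λ, a • x = op a • x) (a : A) (F : (bisetRep Λ ρ).toSubmodule) :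
    (bisetRep Λ ρ).toRepresentation (a : S) F = (χ a : ℂ) • F := by
  refine Subtype.ext (funext fun x => ?_)
  change F.1 ((a : S)⁻¹ • x) = (χ a : ℂ) • F.1 x
  rw [hA _ (inv_mem a.2), F.2 x _, inv_inv, hρ]

end Representations

/-- Every `A`-representation is a direct summand of an `F`-invariant one, obtained by induction
along a characteristic biset on which both actions of `A` coincide. -/
theorem FusionSystem.IsCharacteristicBiset.exists_isInvariantRep {S : Type u} [Group S]
    [Finite S] {F : FusionSystem S} {p : ℕ} {Λ : Type u} [MulAction S Λ] [MulAction Sᵐᵒᵖ Λ]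
    [SMulCommClass S Sᵐᵒᵖ Λ] (hΛ : F.IsCharacteristicBiset p Λ) {A : Subgroup S}
    (hA : ∀ a ∈ A, ∀ x : Λ, a • x = MulOpposite.op a • x) (x₀ : Λ)
    (hx₀ : ∀ s : S, s • x₀ = MulOpposite.op s • x₀)
    (hfree : ∀ t : S, MulOpposite.op t • x₀ = x₀ → t = 1) (χ : A →* Circle) (n : ℕ)
    (ρ : S →* Matrix.unitaryGroup (Fin n) ℂ) (hρ : IsARep χ ρ) :
    ∃ (m : ℕ) (τ : S →* Matrix.unitaryGroup (Fin m) ℂ),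
      IsARep χ τ ∧ F.IsInvariantRep τ ∧ IsDirectSummand ρ τ := by
  have := hΛ.finite
  obtain ⟨m, τ, ⟨e⟩⟩ := exists_unitaryRep_equiv (bisetRep Λ ρ).toRepresentation
  obtain ⟨k, σ, ⟨e'⟩⟩ := exists_unitaryRep_equiv (bisetRepOff ρ x₀ hx₀).toRepresentation
  have he : ∀ s v, e (unitaryRep τ s v) = (bisetRep Λ ρ).toRepresentation s (e v) := fun s v =>
    LinearMap.congr_fun (e.isIntertwining' s) v
  refine ⟨m, τ, fun a v => ?_, fun P f hf => ?_, k, σ, ?_⟩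
  · refine e.toLinearEquiv.injective ((he a v).trans ?_)
    rw [bisetRep_apply_of_isARep hρ hA]
    exact (e.toLinearEquiv.map_smul _ v).symm
  · obtain ⟨ε, hε, hε'⟩ := hΛ.stable P f hf
    obtain ⟨E⟩ := bisetRep_comp_equiv ρ P.subtype f ε hε hε'
    have hrestrict : ∀ g : P →* S, Nonempty ((unitaryRep (τ.comp g)).Equiv
        ((bisetRep Λ ρ).toRepresentation.comp g)) := fun g =>
      ⟨Representation.Equiv.mk e.toLinearEquiv fun x => e.isIntertwining' (g x)⟩
    obtain ⟨e₁⟩ := hrestrict P.subtype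
    obtain ⟨e₂⟩ := hrestrict f
    exact ⟨(e₁.trans E).trans e₂.symm⟩
  · obtain ⟨E⟩ := bisetRep_equiv_prod ρ x₀ hx₀ hfree
    exact ⟨(e.trans E).trans (Representation.Equiv.prodCongrRight (unitaryRep ρ) e').symm⟩

theorem mainTheorem6 (p : ℕ) [Fact p.Prime] (S : Type u) [Group S] [Finite S]
    (hS : IsPGroup p S) (F : FusionSystem S) (hF : F.IsSaturated p)
    (A : Subgroup S) (hA : A ≤ F.center) :
    (∃ (Λ : Type u) (_ : MulAction S Λ) (_ : MulAction Sᵐᵒᵖ Λ) (_ : SMulCommClass S Sᵐᵒᵖ Λ),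
      F.IsCharacteristicBiset p Λ ∧ ∀ a ∈ A, ∀ x : Λ, a • x = MulOpposite.op a • x) ∧
    (∀ (χ : A →* Circle) (n : ℕ) (ρ : S →* Matrix.unitaryGroup (Fin n) ℂ), IsARep χ ρ →
      ∃ (m : ℕ) (τ : S →* Matrix.unitaryGroup (Fin m) ℂ),
        IsARep χ τ ∧ F.IsInvariantRep τ ∧ IsDirectSummand ρ τ) := by
  obtain ⟨Λ, _, _, _, hΛ, hAΛ, hfree, x₀, hx₀⟩ :=
    FusionSystem.exists_isCharacteristicBiset hS hF hA
  exact ⟨⟨Λ, _, _, _, hΛ, hAΛ⟩, hΛ.exists_isInvariantRep hAΛ x₀ hx₀ fun t => hfree t x₀⟩
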